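/- **Setting.** Let $\mathcal X\subseteq\mathbb R^{N_1}$, $Q\in\mathbb R^{N_2\times K}$, $q\in\mathbb R^{N_2}$, $W\in\mathbb R^{M\times N_2}$, $S\in\mathbb R^{J\times K}$, $t\in\mathbb R^J$, and let $T(x)\in\mathbb R^{M\times K}$ and $h(x)\in\mathbb R^M$ be affine functions of $x\in\mathbb R^{N_1}$. Put $\Xi=\{\xi\in\mathbb R^K_+: S\xi\le t\}$. Let $\hat\xi_1,\dots,\hat\xi_I\in\Xi$ with $I\ge 1$, let $\hat{\mathbb P}_I=\frac1I\sum_{i=1}^I\delta_{\hat\xi_i}$, and let $\epsilon\ge 0$. For $x\in\mathbb R^{N_1}$ and $\xi\in\mathbb R^K$ let $$Z(x,\xi)=\inf\{(Q\xi+q)^\top y : y\in\mathbb R^{N_2},\ T(x)\xi+h(x)\le Wy\}\in[-\infty,+\infty],\qquad \mathcal Z(x)=\sup_{\mathbb P}\ \mathbb E_{\mathbb P}[Z(x,\tilde\xi)],$$ where the supremum is over all probability measures $\mathbb P$ supported on $\Xi$ with finite second moment whose 2-Wasserstein distance (with respect to the Euclidean norm) from $\hat{\mathbb P}_I$ is at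 most $\epsilon$. Assume sufficiently expensive recourse: for every $\xi\in\Xi$ there is $p\in\mathbb R^M_+$ with $Q\xi+q=W^\top p$. Set $$\mathcal Q=\begin{bmatrix}Q\\S\end{bmatrix},\quad \mathscr q=\begin{bmatrix}q\\-t\end{bmatrix},\quad \mathcal T(x)=\begin{bmatrix}T(x)\\0\end{bmatrix},\quad \mathscr h(x)=\begin{bmatrix}h(x)\\0\end{bmatrix},\quad \mathcal W=\begin{bmatrix}W&0\\0&-\mathbb I\end{bmatrix}.$$ Write $A\succeq_{\mathcal C}0$ if the symmetric matrix $A$ is copositive ($z^\top Az\ge0$ for all $z\ge0$), and $A\succeq_{\mathcal C^*}0$ if $A$ is completely positive ($A=BB^\top$ for some entrywise nonnegative matrix $B$). For $\delta>0$ let $\overline{\mathcal Z}_\delta(x)$ be the infimum of $$\epsilon^2\lambda+\frac1I\sum_{i=1}^I\Big[s_i+\mathscr q^\top\psi_i-\lambda\|\hat\xi_i\|_2^2+\sum_{j=1}^{N_2+J}\phi_{ij}\mathscr q_j^2\Big]$$ over all $\lambda\ge0$, $s_i\in\mathbb R$ and $\psi_i,\phi_i\in\mathbb R^{N_2+J}$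 ($i=1,\dots,I$) such that, for every $i$, $$\begin{bmatrix}\lambda\mathbb I+\mathcal Q^\top\mathrm{diag}(\phi_i)\mathcal Q & -\frac12\mathcal T(x)^\top-\mathcal Q^\top\mathrm{diag}(\phi_i)\mathcal W^\top & -\lambda\hat\xi_i-\frac12\mathcal Q^\top\psi_i\\ -\frac12\mathcal T(x)-\mathcal W\mathrm{diag}(\phi_i)\mathcal Q & \mathcal W\mathrm{diag}(\phi_i)\mathcal W^\top+\delta\mathbb I & \frac12(\mathcal W\psi_i-\mathscr h(x))\\ (-\lambda\hat\xi_i-\frac12\mathcal Q^\top\psi_i)^\top & \frac12(\mathcal W\psi_i-\mathscr h(x))^\top & s_i\end{bmatrix}\succeq_{\mathcal C}0,$$ and let $\underline{\mathcal Z}_\delta(x)$ be the supremum of $$\frac1I\sum_{i=1}^I\big[\mathrm{tr}(\mathcal T(x)Y_i)+\mathscr h(x)^\top\gamma_i-\delta\,\mathrm{tr}(\Gamma_i)\big]$$ over all $\gamma_i\in\mathbb R^{M+J}_+$, $\mu_i\in\mathbb R^K_+$, positive semidefinite $\Gamma_i\in\mathbb R^{(M+J)\times(M+J)}$ and $\Omega_i\in\mathbb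 R^{K\times K}$, and $Y_i\in\mathbb R^{K\times(M+J)}$ such that, for all $i$ and all $j\in\{1,\dots,N_2+J\}$, $$\mathcal Q\mu_i+\mathscr q=\mathcal W^\top\gamma_i,\qquad \mathcal Q_{j:}^\top\Omega_i\mathcal Q_{j:}-2\mathcal Q_{j:}^\top Y_i\mathcal W_{:j}+\mathcal W_{:j}^\top\Gamma_i\mathcal W_{:j}=\mathscr q_j^2,$$ $$\frac1I\sum_{i'=1}^I\big[\mathrm{tr}(\Omega_{i'})-2\hat\xi_{i'}^\top\mu_{i'}+\hat\xi_{i'}^\top\hat\xi_{i'}\big]\le\epsilon^2,\qquad \begin{bmatrix}\Omega_i&Y_i&\mu_i\\Y_i^\top&\Gamma_i&\gamma_i\\\mu_i^\top&\gamma_i^\top&1\end{bmatrix}\succeq_{\mathcal C^*}0,$$ where $\mathcal Q_{j:}$ is the $j$-th row of $\mathcal Q$ (as a column vector) and $\mathcal W_{:j}$ the $j$-th column of $\mathcal W$. **Proposition.** For every fixed $x\in\mathcal X$ and every $\delta>0$, the values $\overline{\mathcal Z}_\delta(x)$ and $\underline{\mathcal Z}_\delta(x)$ are equal and finite. Moreover,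 $\lim_{\delta\downarrow0}\overline{\mathcal Z}_\delta(x)=\mathcal Z(x)$, where $\mathcal Z(x)\in(-\infty,+\infty]$ may be $+\infty$. -/

import Mathlib

open Matrix MeasureTheory Filter
open scoped ENNReal Topology

noncomputable section

/-- A real symmetric matrix `A` is copositive if `zᵀ A z ≥ 0` for all entrywise nonnegative `z`. -/
def IsCopositive {n : Type*} [Fintype n] (A : Matrix n n ℝ) : Prop :=
  A.IsSymm ∧ ∀ z : n → ℝ, 0 ≤ z → 0 ≤ z ⬝ᵥ (A *ᵥ z)

/-- A real square matrix `A` is completely positive if `A = B Bᵀ` for some entrywise nonnegative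
matrix `B` with finitely many columns. -/
def IsCompletelyPositive {n : Type*} (A : Matrix n n ℝ) : Prop :=
  ∃ (k : ℕ) (B : Matrix n (Fin k) ℝ), (∀ a l, 0 ≤ B a l) ∧ A = B * Bᵀ

/-- The matrix `[[A, B, u], [Bᵀ, C, v], [uᵀ, vᵀ, c]]`. -/
def borderedBlock {m n : Type*} (A : Matrix m m ℝ) (B : Matrix m n ℝ) (u : m → ℝ)
    (C : Matrix n n ℝ) (v : n → ℝ) (c : ℝ) : Matrix ((m ⊕ n) ⊕ Unit) ((m ⊕ n) ⊕ Unit) ℝ :=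
  Matrix.fromBlocks (Matrix.fromBlocks A B Bᵀ C)
    (Matrix.replicateCol Unit (Sum.elim u v))
    (Matrix.replicateRow Unit (Sum.elim u v))
    (Matrix.of fun _ _ => c)

/-- The expectation `E_P[f⁺] - E_P[f⁻]` of an extended real valued function. -/
def extExpectation {α : Type*} [MeasurableSpace α] (P : Measure α) (f : α → EReal) : EReal :=
  ((∫⁻ a, (f a).toENNReal ∂P : ℝ≥0∞) : EReal) - ((∫⁻ a, (-f a).toENNReal ∂P : ℝ≥0∞) : EReal)

/-- The 2-Wasserstein distance of two measures with respect to the Euclidean norm. -/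
def wasserstein2 {K : ℕ} (P₁ P₂ : Measure (EuclideanSpace ℝ (Fin K))) : ℝ≥0∞ :=
  ⨅ (ρ : Measure (EuclideanSpace ℝ (Fin K) × EuclideanSpace ℝ (Fin K)))
    (_ : ρ.map Prod.fst = P₁ ∧ ρ.map Prod.snd = P₂),
      (∫⁻ z, ‖z.1 - z.2‖ₑ ^ 2 ∂ρ) ^ (1 / 2 : ℝ)

/-- The probability measures supported on `Ξ` with a finite second moment around some reference
point of `Ξ`. -/
def secondMomentMeasures {K : ℕ} (Ξ : Set (EuclideanSpace ℝ (Fin K))) :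
    Set (Measure (EuclideanSpace ℝ (Fin K))) :=
  {P | IsProbabilityMeasure P ∧ P Ξᶜ = 0 ∧ ∃ ξ₀ ∈ Ξ, ∫⁻ ξ, ‖ξ - ξ₀‖ₑ ^ 2 ∂P < ∞}

/-- The data of a two-stage distributionally robust linear program: the feasible set `X` of
first-stage decisions, the recourse data `Q`, `q`, `T`, `h`, `W`, the data `S`, `t` of the support
set, the samples, and the Wasserstein radius. -/
structure TwoStageDRLP (N₁ N₂ K M J I : ℕ) where
  X : Set (Fin N₁ → ℝ)
  Q : Matrix (Fin N₂) (Fin K) ℝ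
  q : Fin N₂ → ℝ
  T : (Fin N₁ → ℝ) →ᵃ[ℝ] Matrix (Fin M) (Fin K) ℝ
  h : (Fin N₁ → ℝ) →ᵃ[ℝ] (Fin M → ℝ)
  W : Matrix (Fin M) (Fin N₂) ℝ
  S : Matrix (Fin J) (Fin K) ℝ
  t : Fin J → ℝ
  sample : Fin I → EuclideanSpace ℝ (Fin K)
  radius : ℝ

namespace TwoStageDRLP

variable {N₁ N₂ K M J I : ℕ} (D : TwoStageDRLP N₁ N₂ K M J I)

/-- The support set `Ξ = {ξ ≥ 0 : S ξ ≤ t}`. -/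
def support : Set (EuclideanSpace ℝ (Fin K)) :=
  {ξ | 0 ≤ ξ.ofLp ∧ D.S *ᵥ ξ.ofLp ≤ D.t}

/-- The recourse function: the infimum of `(Q ξ + q)ᵀ y` over all `y` with
`T(x) ξ + h(x) ≤ W y`; it is `⊤` if there is no such `y`. -/
def recourse (x : Fin N₁ → ℝ) (ξ : EuclideanSpace ℝ (Fin K)) : EReal :=
  ⨅ (y : Fin N₂ → ℝ) (_ : D.T x *ᵥ ξ.ofLp + D.h x ≤ D.W *ᵥ y),
    (((D.Q *ᵥ ξ.ofLp + D.q) ⬝ᵥ y : ℝ) : EReal)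

/-- Sufficiently expensive recourse: the dual of the recourse problem is feasible for all
`ξ ∈ Ξ`. -/
def SufficientlyExpensiveRecourse : Prop :=
  ∀ ξ ∈ D.support, ∃ p : Fin M → ℝ, 0 ≤ p ∧ D.Q *ᵥ ξ.ofLp + D.q = D.Wᵀ *ᵥ p

/-- The uniform distribution on the samples. -/
def empirical : Measure (EuclideanSpace ℝ (Fin K)) :=
  (I : ℝ≥0∞)⁻¹ • ∑ i, Measure.dirac (D.sample i)

/-- The 2-Wasserstein ball around the empirical distribution. -/
def ambiguitySet : Set (Measure (EuclideanSpace ℝ (Fin K))) :=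
  {P | P ∈ secondMomentMeasures D.support ∧ wasserstein2 P D.empirical ≤ ENNReal.ofReal D.radius}

/-- The worst-case expected recourse cost. -/
def worstCase (x : Fin N₁ → ℝ) : EReal :=
  ⨆ P ∈ D.ambiguitySet, extExpectation P (D.recourse x)

/-! The extended recourse parameters. -/

/-- `[Q; S]` -/
def extQ : Matrix (Fin N₂ ⊕ Fin J) (Fin K) ℝ := Matrix.fromRows D.Q D.S

/-- `[q; -t]` -/
def extq : Fin N₂ ⊕ Fin J → ℝ := Sum.elim D.q (-D.t)

/-- `[T(x); 0]` -/
def extT (x : Fin N₁ → ℝ) : Matrix (Fin M ⊕ Fin J) (Fin K) ℝ := Matrix.fromRows (D.T x) 0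

/-- `[h(x); 0]` -/
def exth (x : Fin N₁ → ℝ) : Fin M ⊕ Fin J → ℝ := Sum.elim (D.h x) 0

/-- `[[W, 0], [0, -1]]` -/
def extW : Matrix (Fin M ⊕ Fin J) (Fin N₂ ⊕ Fin J) ℝ := Matrix.fromBlocks D.W 0 0 (-1)

/-- The decision variables of the copositive program. -/
structure CopositiveVars (N₂ J I : ℕ) where
  lam : ℝ
  s : Fin I → ℝ
  ψ : Fin I → Fin N₂ ⊕ Fin J → ℝ
  φ : Fin I → Fin N₂ ⊕ Fin J → ℝ

/-- The objective function of the (perturbed) copositive program. -/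
def copositiveObjective (v : CopositiveVars N₂ J I) : ℝ :=
  D.radius ^ 2 * v.lam + (1 / (I : ℝ)) * ∑ i,
    (v.s i + D.extq ⬝ᵥ v.ψ i - v.lam * ‖D.sample i‖ ^ 2 + ∑ j, v.φ i j * D.extq j ^ 2)

/-- The `i`-th constraint matrix of the perturbed copositive program. -/
def copositiveMatrix (x : Fin N₁ → ℝ) (δ : ℝ) (v : CopositiveVars N₂ J I) (i : Fin I) :
    Matrix ((Fin K ⊕ (Fin M ⊕ Fin J)) ⊕ Unit) ((Fin K ⊕ (Fin M ⊕ Fin J)) ⊕ Unit) ℝ :=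
  borderedBlock
    (v.lam • (1 : Matrix (Fin K) (Fin K) ℝ) + D.extQᵀ * Matrix.diagonal (v.φ i) * D.extQ)
    (-((1 / 2 : ℝ) • (D.extT x)ᵀ) - D.extQᵀ * Matrix.diagonal (v.φ i) * D.extWᵀ)
    (-(v.lam • (D.sample i).ofLp) - (1 / 2 : ℝ) • (D.extQᵀ *ᵥ v.ψ i))
    (D.extW * Matrix.diagonal (v.φ i) * D.extWᵀ +
      δ • (1 : Matrix (Fin M ⊕ Fin J) (Fin M ⊕ Fin J) ℝ))
    ((1 / 2 : ℝ) • (D.extW *ᵥ v.ψ i - D.exth x))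
    (v.s i)

/-- The optimal value of the perturbed copositive program, `⊤` if it is infeasible. -/
def copositiveValue (δ : ℝ) (x : Fin N₁ → ℝ) : EReal :=
  ⨅ (v : CopositiveVars N₂ J I)
    (_ : 0 ≤ v.lam ∧ ∀ i, IsCopositive (D.copositiveMatrix x δ v i)),
    ((D.copositiveObjective v : ℝ) : EReal)

/-- The decision variables of the completely positive program. -/
structure CompletelyPositiveVars (K M J I : ℕ) where
  γ : Fin I → Fin M ⊕ Fin J → ℝ
  μ : Fin I → Fin K → ℝ
  Γ : Fin I → Matrix (Fin M ⊕ Fin J) (Fin M ⊕ Fin J) ℝ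
  Ω : Fin I → Matrix (Fin K) (Fin K) ℝ
  Y : Fin I → Matrix (Fin K) (Fin M ⊕ Fin J) ℝ

/-- The constraints of the completely positive program. Here `D.extQ j` is the `j`-th row of
`D.extQ`, and `D.extW.col j` is the `j`-th column of `D.extW`. -/
structure CompletelyPositiveFeasible (v : CompletelyPositiveVars K M J I) : Prop where
  γ_nonneg : ∀ i, 0 ≤ v.γ i
  μ_nonneg : ∀ i, 0 ≤ v.μ i
  Γ_psd : ∀ i, (v.Γ i).PosSemidef
  Ω_psd : ∀ i, (v.Ω i).PosSemidef
  linear : ∀ i, D.extQ *ᵥ v.μ i + D.extq = D.extWᵀ *ᵥ v.γ i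
  quadratic : ∀ i j,
    D.extQ j ⬝ᵥ (v.Ω i *ᵥ D.extQ j) - 2 * (D.extQ j ⬝ᵥ (v.Y i *ᵥ D.extW.col j)) +
      D.extW.col j ⬝ᵥ (v.Γ i *ᵥ D.extW.col j) = D.extq j ^ 2
  radius_bound : (1 / (I : ℝ)) * ∑ i,
    ((v.Ω i).trace - 2 * ((D.sample i).ofLp ⬝ᵥ v.μ i) +
      (D.sample i).ofLp ⬝ᵥ (D.sample i).ofLp) ≤ D.radius ^ 2
  completelyPositive : ∀ i,
    IsCompletelyPositive (borderedBlock (v.Ω i) (v.Y i) (v.μ i) (v.Γ i) (v.γ i) 1)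

/-- The objective function of the perturbed completely positive program. -/
def completelyPositiveObjective (x : Fin N₁ → ℝ) (δ : ℝ) (v : CompletelyPositiveVars K M J I) :
    ℝ :=
  (1 / (I : ℝ)) * ∑ i,
    ((D.extT x * v.Y i).trace + D.exth x ⬝ᵥ v.γ i - δ * (v.Γ i).trace)

/-- The optimal value of the perturbed completely positive program, `⊥` if it is infeasible. -/
def completelyPositiveValue (δ : ℝ) (x : Fin N₁ → ℝ) : EReal :=
  ⨆ (v : CompletelyPositiveVars K M J I) (_ : D.CompletelyPositiveFeasible v),
    ((D.completelyPositiveObjective x δ v : ℝ) : EReal)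

end TwoStageDRLP

end

/-! Testing a constraint matrix on a nonnegative vector `(a, b, c)` turns copositivity into the
inequality `dualForm ≤ linearForm`. Here `dualForm` is the homogenized dual objective of the
recourse problem, regularized by `-δ‖b‖²`, and `linearForm` is linear in the decision variables. For
`c = 1`, a vector `b` with `residual a b = -extq` consists of a recourse dual solution at `ξ = a`
and the slack of `S ξ ≤ t`. On such vectors `linearForm` is a constant plus `λ‖ξ - ξ̂ᵢ‖²`, which is
the integrand of Wasserstein duality.

A completely positive matrix is a sum of squares of nonnegative atoms `(a, b, c)`. The linear and
quadratic constraints force `residual a b = -c • extq` on every atom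
(`CompletelyPositiveFeasible.exists_atoms`). Summing the copositive inequalities over the atoms
gives weak duality. For `δ > 0` the term `δ‖b‖²` dominates the cross terms, so a Slater point exists
(`exists_slater`). The constraints form a compact family after restriction to the simplex, and their
multipliers are atoms of a completely positive solution. This gives strong duality
(`exists_completelyPositiveFeasible_ge`), and finiteness follows from the Slater point and from the
samples themselves.

For the limit, the completely positive value is at most the worst case: atoms with `c > 0` are point
masses at `a / c` of weight proportional to `c²`, and atoms with `c = 0` are reached by a
perturbation (`completelyPositiveObjective_le_worstCase`). Conversely, a common bound on the
copositive values for all `δ` bounds the integral of the regularized recourse under every measure of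
the ball. Letting `δ` decrease to zero by monotone convergence bounds the worst case
(`worstCase_le_of_copositiveValue_le`). Since the copositive value is antitone in `δ`, the two
bounds give convergence, also when the worst case is infinite. -/

/-! ### Linear and convex duality in finite dimension -/

/-- Farkas' lemma: a linear functional that is nonpositive wherever finitely many functionals are
nonpositive is a nonnegative combination of them. -/
theorem exists_nonneg_combination_of_forall_nonpos {V : Type*} [AddCommGroup V] [Module ℝ V]
    (n : ℕ) (f : Fin n → V →ₗ[ℝ] ℝ) (g : V →ₗ[ℝ] ℝ)
    (h : ∀ v, (∀ i, f i v ≤ 0) → g v ≤ 0) :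
    ∃ w : Fin n → ℝ, (∀ i, 0 ≤ w i) ∧ ∀ v, g v = ∑ i, w i * f i v := by
  induction n generalizing g with
  | zero =>
    refine ⟨0, fun i => i.elim0, fun v => ?_⟩
    have h1 := h v (fun i => i.elim0)
    have h2 := h (-v) (fun i => i.elim0)
    rw [map_neg] at h2
    simp only [Finset.univ_eq_empty, Finset.sum_empty]
    linarith
  | succ n ih =>
    by_cases hn : ∀ v, (∀ i : Fin n, f i.succ v ≤ 0) → g v ≤ 0
    · obtain ⟨w, hw, hg⟩ := ih (fun i => f i.succ) g hn
      refine ⟨Fin.cons 0 w, fun i => Fin.cases (by simp) (by simpa using hw) i, fun v => ?_⟩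
      simp [Fin.sum_univ_succ, hg v]
    · push Not at hn
      obtain ⟨u, hu, hgu⟩ := hn
      have hf0 : 0 < f 0 u := by
        by_contra hle
        exact absurd (h u (fun i => Fin.cases (not_lt.mp hle) hu i)) (not_le.mpr hgu)
      -- Project along `u` onto the kernel of `f 0`, where the constraint of `f 0` holds trivially.
      -- Composing with this projection turns the other functionals into the corrected ones, to
      -- which the induction hypothesis applies.
      have key : ∀ v, (∀ i : Fin n, (f i.succ - (f i.succ u / f 0 u) • f 0) v ≤ 0) →
          (g - (g u / f 0 u) • f 0) v ≤ 0 := by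
        intro v hv
        have := h (v - (f 0 v / f 0 u) • u) (fun i => by
          refine Fin.cases ?_ (fun i => ?_) i
          · simp [hf0.ne']
          · have := hv i
            simp only [LinearMap.sub_apply, LinearMap.smul_apply, smul_eq_mul, map_sub,
              map_smul] at this ⊢
            convert this using 1
            ring)
        simp only [LinearMap.sub_apply, LinearMap.smul_apply, smul_eq_mul, map_sub,
              map_smul] at this ⊢
        convert this using 1
        ring
      obtain ⟨w, hw, hg⟩ := ih _ _ key
      refine ⟨Fin.cons ((g u - ∑ i, w i * f i.succ u) / f 0 u) w,
        fun i => Fin.cases ?_ (by simpa using hw) i, ?_⟩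
      swap
      · refine div_nonneg ?_ hf0.le
        have : ∑ i, w i * f i.succ u ≤ 0 :=
          Finset.sum_nonpos fun i _ => mul_nonpos_of_nonneg_of_nonpos (hw i) (hu i)
        linarith
      · intro v
        have := hg v
        simp only [LinearMap.sub_apply, LinearMap.smul_apply, smul_eq_mul, mul_sub,
          Finset.sum_sub_distrib] at this
        simp only [Fin.sum_univ_succ, Fin.cons_zero, Fin.cons_succ, sub_div, sub_mul]
        have e : ∑ i, w i * (f i.succ u / f 0 u * f 0 v) =
            (∑ i, w i * f i.succ u) / f 0 u * f 0 v := by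
          rw [Finset.sum_div, Finset.sum_mul]
          exact Finset.sum_congr rfl fun i _ => by ring
        rw [e] at this
        linarith

/-- Strong duality of linear programming: if the dual program is feasible and its values are
bounded by `r`, then the primal program has a solution of value at most `r`. -/
theorem exists_primal_le_of_forall_dual_le {m n : ℕ} (W : Matrix (Fin m) (Fin n) ℝ)
    (b : Fin m → ℝ) (c : Fin n → ℝ) (r : ℝ) (p₀ : Fin m → ℝ) (hp₀ : 0 ≤ p₀)
    (hc : c = Wᵀ *ᵥ p₀) (hr : ∀ p : Fin m → ℝ, 0 ≤ p → c = Wᵀ *ᵥ p → b ⬝ᵥ p ≤ r) :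
    ∃ y : Fin n → ℝ, b ≤ W *ᵥ y ∧ c ⬝ᵥ y ≤ r := by
  by_contra hno
  push Not at hno
  -- Homogenize to pairs `(y, t)`: if no `y` works, then `c ⬝ᵥ y ≤ t * r` and `t • b ≤ W *ᵥ y` force
  -- `t ≤ 0`.
  let f : Fin (m + 1) → ((Fin n → ℝ) × ℝ) →ₗ[ℝ] ℝ :=
    Fin.cons
      ({ toFun := fun v => c ⬝ᵥ v.1 - v.2 * r
         map_add' := fun v w => by simp only [Prod.fst_add, Prod.snd_add, dotProduct_add]; ring
         map_smul' := fun a v => by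
          simp only [Prod.smul_fst, Prod.smul_snd, dotProduct_smul, smul_eq_mul,
            RingHom.id_apply]; ring })
      (fun i =>
       { toFun := fun v => v.2 * b i - (W *ᵥ v.1) i
         map_add' := fun v w => by
          simp only [Prod.fst_add, Prod.snd_add, mulVec_add, Pi.add_apply]; ring
         map_smul' := fun a v => by
          simp only [Prod.smul_fst, Prod.smul_snd, mulVec_smul, smul_eq_mul,
            RingHom.id_apply, Pi.smul_apply]; ring })
  have hf0 : ∀ v, f 0 v = c ⬝ᵥ v.1 - v.2 * r := fun v => rfl
  have hf1 : ∀ i v, f (Fin.succ i) v = v.2 * b i - (W *ᵥ v.1) i := fun i v => rfl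
  obtain ⟨w, hw, hg⟩ := exists_nonneg_combination_of_forall_nonpos (m + 1) f
    (LinearMap.snd ℝ (Fin n → ℝ) ℝ) (fun v hv => by
      by_contra hpos
      rw [LinearMap.snd_apply, not_le] at hpos
      have h1 : b ≤ W *ᵥ (v.2⁻¹ • v.1) := fun i => by
        have := hv i.succ
        rw [hf1] at this
        rw [mulVec_smul, Pi.smul_apply, smul_eq_mul, inv_mul_eq_div, le_div_iff₀ hpos]
        linarith
      have h2 := hno _ h1
      have h3 := hv 0
      rw [hf0] at h3
      rw [dotProduct_smul, smul_eq_mul, inv_mul_eq_div, lt_div_iff₀ hpos] at h2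
      linarith)
  set u : Fin m → ℝ := fun i => w i.succ with hu
  have hu0 : 0 ≤ u := fun i => hw _
  have e1 : 1 = -(w 0 * r) + u ⬝ᵥ b := by
    have := hg (0, 1)
    simpa [Fin.sum_univ_succ, hf0, hf1, dotProduct] using this
  have e2 : w 0 • c = Wᵀ *ᵥ u := by
    ext j
    have := hg (Pi.single j 1, 0)
    simp only [LinearMap.snd_apply, Fin.sum_univ_succ, hf0, hf1] at this
    simp only [dotProduct_single, mul_one, zero_mul, sub_zero, zero_sub, mulVec_single_one,
      mul_neg, Finset.sum_neg_distrib] at this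
    simp only [Pi.smul_apply, smul_eq_mul, mulVec, dotProduct, transpose_apply, hu]
    simp only [col_apply] at this
    rw [Finset.sum_congr rfl fun i _ => mul_comm (W i j) (w i.succ)]
    linarith
  have hw0 := hw 0
  set d := r - b ⬝ᵥ p₀ with hd
  have hd0 : 0 ≤ d := sub_nonneg.mpr (hr p₀ hp₀ hc)
  -- The multiplier `w 0` may vanish, and then `u` is only a recession direction of the dual. Mixing
  -- in `η • p₀` makes normalization possible, and the resulting dual point violates `hr` as soon as
  -- `η * d < 1`.
  set η : ℝ := 1 / (2 * (1 + d)) with hη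
  have hη0 : 0 < η := by positivity
  have hs : 0 < w 0 + η := by positivity
  have := hr ((w 0 + η)⁻¹ • (u + η • p₀))
    (smul_nonneg (by positivity) (add_nonneg hu0 (smul_nonneg hη0.le hp₀))) (by
      rw [mulVec_smul, mulVec_add, mulVec_smul, ← e2, ← hc, ← add_smul, smul_smul,
        inv_mul_cancel₀ hs.ne', one_smul])
  rw [dotProduct_smul, smul_eq_mul, inv_mul_eq_div, div_le_iff₀ hs, dotProduct_add,
    dotProduct_smul, smul_eq_mul, dotProduct_comm b u] at this
  have h4 : η * d < 1 := by
    rw [hη, one_div, inv_mul_lt_iff₀ (by positivity)]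
    linarith
  have h5 : η * d = η * r - η * (b ⬝ᵥ p₀) := by rw [hd]; ring
  nlinarith

/-- The convex hull of a compact set of a finite-dimensional space is compact. -/
theorem IsCompact.convexHull_of_finiteDimensional {E : Type*} [NormedAddCommGroup E]
    [NormedSpace ℝ E] [FiniteDimensional ℝ E] {s : Set E} (hs : IsCompact s) :
    IsCompact (convexHull ℝ s) := by
  rcases s.eq_empty_or_nonempty with rfl | ⟨x₀, hx₀⟩
  · simp
  let d := Module.finrank ℝ E + 1
  -- By Carathéodory, `d` points suffice. Shorter combinations are padded with `x₀` at weight zero.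
  have himage : convexHull ℝ s = (fun p : (Fin d → ℝ) × (Fin d → E) => ∑ j, p.1 j • p.2 j) ''
      (stdSimplex ℝ (Fin d) ×ˢ Set.univ.pi fun _ => s) := by
    refine Set.Subset.antisymm (fun x hx => ?_) ?_
    · obtain ⟨ι, _, z, w, hz, hind, hw, hw1, rfl⟩ := eq_pos_convex_span_of_mem_convexHull hx
      have hcard : Fintype.card ι ≤ Fintype.card (Fin d) := by
        simpa [d] using hind.card_le_finrank_succ.trans
          (Nat.succ_le_succ (Submodule.finrank_le _))
      obtain ⟨e⟩ := Function.Embedding.nonempty_of_card_le hcard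
      have hnot : ∀ j, j ∉ Set.range e → Function.extend e w 0 j = 0 := fun j hj =>
        Function.extend_apply' _ _ _ hj
      refine ⟨(Function.extend e w 0, Function.extend e z fun _ => x₀), ⟨⟨fun j => ?_, ?_⟩, ?_⟩, ?_⟩
      · by_cases hj : j ∈ Set.range e
        · obtain ⟨i, rfl⟩ := hj
          simpa [e.injective.extend_apply] using (hw i).le
        · exact (hnot j hj).ge
      · rw [← hw1]
        exact (Fintype.sum_of_injective e e.injective _ _ hnot
          fun i => (e.injective.extend_apply _ _ _).symm).symm
      · intro j _
        by_cases hj : j ∈ Set.range e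
        · obtain ⟨i, rfl⟩ := hj
          simpa [e.injective.extend_apply] using hz ⟨i, rfl⟩
        · simpa [Function.extend_apply' _ _ _ hj] using hx₀
      · exact (Fintype.sum_of_injective e e.injective _ _
          (fun j hj => by simp [hnot j hj])
          fun i => by simp [e.injective.extend_apply]).symm
    · rintro _ ⟨p, ⟨hp1, hp2⟩, rfl⟩
      exact (convex_convexHull ℝ s).sum_mem (fun j _ => hp1.1 j) hp1.2
        fun j _ => subset_convexHull ℝ s (hp2 j trivial)
  rw [himage]
  exact ((isCompact_stdSimplex ℝ (Fin d)).prod (isCompact_univ_pi fun _ => hs)).image (by fun_prop)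

/-- Lagrange multipliers for a linear program with a compact family of affine constraints that
satisfies the Slater condition. -/
theorem exists_multipliers_of_slater {E Θ : Type*} [NormedAddCommGroup E] [NormedSpace ℝ E]
    [FiniteDimensional ℝ E] [TopologicalSpace Θ] [CompactSpace Θ]
    (g : Θ → E →L[ℝ] ℝ) (b : Θ → ℝ) (hg : ∀ v, Continuous fun θ => g θ v) (hb : Continuous b)
    (c : E →L[ℝ] ℝ) (m : ℝ) (v₀ : E) (hv₀ : ∀ θ, 0 < g θ v₀ + b θ)
    (hm : ∀ v, (∀ θ, 0 ≤ g θ v + b θ) → m ≤ c v) :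
    ∃ (ι : Type) (_ : Fintype ι) (θ : ι → Θ) (w : ι → ℝ), (∀ l, 0 ≤ w l) ∧
      (∀ v, c v = ∑ l, w l * g (θ l) v) ∧ m ≤ -∑ l, w l * b (θ l) := by
  let G := (E × ℝ) →L[ℝ] ℝ
  -- The homogenized constraints on `(v, t)`, with `none` standing for `t ≥ 0`. The claim becomes
  -- that `c - m t` lies in the cone they generate.
  let F : Option Θ → G := fun o => o.elim (ContinuousLinearMap.snd ℝ E ℝ)
    (fun θ => (g θ).comp (ContinuousLinearMap.fst ℝ E ℝ) + b θ • ContinuousLinearMap.snd ℝ E ℝ)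
  have hF0 : ∀ v, F none v = v.2 := fun v => rfl
  have hF1 : ∀ θ v, F (some θ) v = g θ v.1 + b θ * v.2 := fun θ v => rfl
  have hrange : Set.range F = insert (F none) (Set.range fun θ => F (some θ)) := by
    ext k
    simp [Option.exists, eq_comm]
  have hcont : Continuous fun θ => F (some θ) := by
    rw [continuous_clm_apply]
    intro v
    simp only [hF1]
    exact (hg _).add (hb.mul continuous_const)
  have hcompact : IsCompact (convexHull ℝ (Set.range F)) := by
    rw [hrange]
    exact ((isCompact_range hcont).insert _).convexHull_of_finiteDimensional
  let w : G := c.comp (ContinuousLinearMap.fst ℝ E ℝ) - m • ContinuousLinearMap.snd ℝ E ℝ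
  have hw : ∀ v, w v = c v.1 - m * v.2 := fun v => rfl
  -- The Slater point keeps zero out of the compact hull. Hence the hull misses the ray through `w`
  -- including its apex, and strict separation is available.
  have hpos : ∀ k ∈ convexHull ℝ (Set.range F), 0 < k (v₀, (1 : ℝ)) := by
    have hsub : convexHull ℝ (Set.range F) ⊆ {k : G | 0 < k (v₀, (1 : ℝ))} := by
      refine convexHull_min ?_ ?_
      · rintro _ ⟨o, rfl⟩
        cases o with
        | none => simp [hF0]
        | some θ => simpa [hF1] using hv₀ θ
      · exact convex_halfSpace_gt (f := fun k : G => k (v₀, (1 : ℝ)))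
          ⟨fun _ _ => rfl, fun _ _ => rfl⟩ 0
    exact fun k hk => hsub hk
  have key : ∃ k ∈ convexHull ℝ (Set.range F), ∃ y : ℝ, 0 ≤ y ∧ w = y • k := by
    by_contra hno
    push Not at hno
    have hne : (convexHull ℝ (Set.range F)).Nonempty := ⟨_, subset_convexHull ℝ _ ⟨none, rfl⟩⟩
    have hw0 : w ≠ 0 := by
      obtain ⟨k, hk⟩ := hne
      simpa using hno k hk 0 le_rfl
    let R : Set G := (fun s : ℝ => s • w) '' Set.Ici 0
    have hRc : IsClosed R := (isClosedEmbedding_smul_left hw0).isClosedMap _ isClosed_Ici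
    have hRconv : Convex ℝ R :=
      (convex_Ici (0 : ℝ)).is_linear_image ⟨fun a b => add_smul a b w, fun a b => by
        simp [smul_smul]⟩
    have hdisj : Disjoint (convexHull ℝ (Set.range F)) R := by
      rw [Set.disjoint_left]
      rintro k hk ⟨s, hs, rfl⟩
      rcases (Set.mem_Ici.mp hs).eq_or_lt with h0 | h0
      · have := hpos _ hk
        simp [← h0] at this
      · exact hno _ hk s⁻¹ (inv_nonneg.mpr h0.le) (by simp [smul_smul, h0.ne'])
    obtain ⟨f, u₁, u₂, h1, h12, h2⟩ :=
      geometric_hahn_banach_compact_closed (convex_convexHull ℝ _) hcompact hRconv hRc hdisj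
    have hu2 : u₂ < 0 := by simpa using h2 0 ⟨0, by simp, by simp⟩
    have hfw : 0 ≤ f w := by
      by_contra hlt
      push Not at hlt
      have := h2 _ ⟨u₂ / f w, Set.mem_Ici.mpr (div_nonneg_of_nonpos hu2.le hlt.le), rfl⟩
      simp [hlt.ne] at this
    obtain ⟨x₀, hx₀⟩ : ∃ x, 0 < w x := by
      by_contra hall
      push Not at hall
      refine hw0 (ContinuousLinearMap.ext fun x => le_antisymm (hall x) ?_)
      simpa using hall (-x)
    -- By reflexivity the separating functional is evaluation at a point `x₁`.
    let Φ : Module.Dual ℝ (Module.Dual ℝ (E × ℝ)) :=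
      (f : G →ₗ[ℝ] ℝ).comp (LinearMap.toContinuousLinearMap (𝕜 := ℝ) (E := E × ℝ)
        (F' := ℝ)).toLinearMap
    obtain ⟨x₁, hx₁⟩ := (Module.evalEquiv ℝ (E × ℝ)).surjective Φ
    have hx₁' : ∀ k : G, f k = k x₁ := fun k => by
      have := congrArg (fun ψ => ψ (k : (E × ℝ) →ₗ[ℝ] ℝ)) hx₁
      simp only [Module.evalEquiv_apply, Φ, LinearMap.comp_apply] at this
      exact this.symm
    obtain ⟨B, hB⟩ := hcompact.exists_bound_of_continuousOn
      (f := fun k : G => k x₀) (by fun_prop)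
    have hB0 : 0 ≤ B := by
      obtain ⟨k, hk⟩ := hne
      exact (norm_nonneg _).trans (hB k hk)
    set η : ℝ := -u₂ / (B + 1) with hη
    have hη0 : 0 < η := div_pos (by linarith) (by linarith)
    have hηB : η * (B + 1) = -u₂ := by
      rw [hη]
      field_simp
    -- The point `-x₁` is positive on the hull but only gives `w ≤ 0`. The shift by `x₀` makes this
    -- strict, and `η` is small enough to preserve positivity on the hull.
    let x : E × ℝ := -x₁ - η • x₀
    have hkx : ∀ k ∈ convexHull ℝ (Set.range F), 0 < k x := fun k hk => by
      have a1 := h1 k hk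
      have a2 := (abs_le.mp (hB k hk)).2
      rw [hx₁'] at a1
      have a3 : k x = -k x₁ - η * k x₀ := by simp [x]
      nlinarith
    have hwx : w x < 0 := by
      have a3 : w x = -w x₁ - η * w x₀ := by simp [x]
      rw [hx₁'] at hfw
      nlinarith [mul_pos hη0 hx₀]
    have hx2 : 0 < x.2 := hkx _ (subset_convexHull ℝ _ ⟨none, rfl⟩)
    have := hm (x.2⁻¹ • x.1) (fun θ => by
      have := hkx _ (subset_convexHull ℝ _ ⟨some θ, rfl⟩)
      rw [hF1] at this
      rw [map_smul, smul_eq_mul]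
      have e : x.2⁻¹ * g θ x.1 + b θ = x.2⁻¹ * (g θ x.1 + b θ * x.2) := by
        field_simp
      rw [e]
      positivity)
    rw [map_smul, smul_eq_mul, inv_mul_eq_div, le_div_iff₀ hx2] at this
    rw [hw] at hwx
    linarith
  obtain ⟨k, hk, y, hy, hwk⟩ := key
  obtain ⟨ι, t, ω, z, hω0, hω1, hz, rfl⟩ := mem_convexHull_iff_exists_fintype.mp hk
  choose o ho using hz
  have hval : ∀ v : E × ℝ, c v.1 - m * v.2 = ∑ l, (y * ω l) * F (o l) v := fun v => by
    rw [← hw, hwk]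
    simp [Finset.mul_sum, mul_assoc, ho]
  -- The terms from `none` vanish at `t = 0` and are a nonnegative slack at `t = 1`, so dropping
  -- them leaves an identity for `c` and an inequality for `m`.
  have hsplit : ∀ v : E × ℝ, c v.1 - m * v.2 =
      ∑ l : {l // (o l).isSome}, (y * ω l) * F (some ((o l).get l.2)) v +
        ∑ l : {l // ¬ (o l).isSome}, (y * ω l) * v.2 := fun v => by
    rw [hval, ← Fintype.sum_subtype_add_sum_subtype (fun l => (o l).isSome)]
    congr 1
    · exact Finset.sum_congr rfl fun l _ => by rw [Option.some_get]
    · exact Finset.sum_congr rfl fun l _ => by rw [Option.not_isSome_iff_eq_none.mp l.2, hF0]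
  refine ⟨{l // (o l).isSome}, inferInstance, fun l => (o l).get l.2, fun l => y * ω l,
    fun l => mul_nonneg hy (hω0 l), fun v => ?_, ?_⟩
  · have := hsplit (v, 0)
    simpa only [hF1, mul_zero, sub_zero, add_zero, Finset.sum_const_zero] using this
  · have := hsplit (0, 1)
    simp only [hF1, map_zero, mul_one, zero_add, zero_sub] at this
    have h0 : 0 ≤ ∑ l : {l // ¬ (o l).isSome}, y * ω l :=
      Finset.sum_nonneg fun l _ => mul_nonneg hy (hω0 l)
    linarith

/-! ### Bordered block matrices and their atoms -/

/-- The quadratic form of a bordered block matrix. -/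
theorem dotProduct_borderedBlock_mulVec {m n : Type*} [Fintype m] [Fintype n]
    (A : Matrix m m ℝ) (B : Matrix m n ℝ) (u : m → ℝ) (C : Matrix n n ℝ) (v : n → ℝ) (s : ℝ)
    (a : m → ℝ) (b : n → ℝ) (c : ℝ) :
    Sum.elim (Sum.elim a b) (fun _ => c) ⬝ᵥ
      (borderedBlock A B u C v s *ᵥ Sum.elim (Sum.elim a b) fun _ => c) =
      a ⬝ᵥ (A *ᵥ a) + 2 * (a ⬝ᵥ (B *ᵥ b)) + b ⬝ᵥ (C *ᵥ b) + 2 * c * (u ⬝ᵥ a) +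
        2 * c * (v ⬝ᵥ b) + s * c ^ 2 := by
  have e1 : (Matrix.replicateCol Unit (Sum.elim u v)) *ᵥ (fun _ => c) =
      Sum.elim (c • u) (c • v) := by
    ext i
    cases i <;> simp [mulVec, dotProduct, mul_comm]
  have e2 : (Matrix.replicateRow Unit (Sum.elim u v)) *ᵥ (Sum.elim a b) =
      fun _ => u ⬝ᵥ a + v ⬝ᵥ b := by
    ext i
    simp [mulVec]
  have e3 : (Matrix.of fun (_ : Unit) (_ : Unit) => s) *ᵥ (fun _ => c) = fun _ => s * c := by
    ext i
    simp [mulVec, dotProduct]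
  have e4 : b ⬝ᵥ (Bᵀ *ᵥ a) = a ⬝ᵥ (B *ᵥ b) := by
    rw [mulVec_transpose, dotProduct_comm, ← dotProduct_mulVec]
  rw [borderedBlock, fromBlocks_mulVec]
  simp only [Sum.elim_comp_inl, Sum.elim_comp_inr, fromBlocks_mulVec, e1, e2, e3,
    sumElim_dotProduct_sumElim, dotProduct_add, e4, dotProduct_smul, smul_eq_mul]
  simp only [dotProduct, Finset.univ_unique, Finset.sum_singleton]
  rw [Finset.sum_congr rfl fun i _ => mul_comm (u i) (a i),
    Finset.sum_congr rfl fun i _ => mul_comm (v i) (b i)]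
  ring

theorem isSymm_borderedBlock {m n : Type*} {A : Matrix m m ℝ} {C : Matrix n n ℝ}
    (hA : A.IsSymm) (B : Matrix m n ℝ) (u : m → ℝ) (hC : C.IsSymm) (v : n → ℝ) (s : ℝ) :
    (borderedBlock A B u C v s).IsSymm := by
  refine Matrix.IsSymm.fromBlocks (Matrix.IsSymm.fromBlocks hA rfl hC) rfl ?_
  ext
  rfl

/-- A completely positive bordered block matrix is a sum of squares of nonnegative vectors. -/
theorem IsCompletelyPositive.exists_atoms {m n : Type*} {A : Matrix m m ℝ} {B : Matrix m n ℝ}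
    {u : m → ℝ} {C : Matrix n n ℝ} {v : n → ℝ} {s : ℝ}
    (h : IsCompletelyPositive (borderedBlock A B u C v s)) :
    ∃ (k : ℕ) (a : Fin k → m → ℝ) (b : Fin k → n → ℝ) (c : Fin k → ℝ),
      (∀ l, 0 ≤ a l) ∧ (∀ l, 0 ≤ b l) ∧ (∀ l, 0 ≤ c l) ∧
      A = ∑ l, vecMulVec (a l) (a l) ∧ B = ∑ l, vecMulVec (a l) (b l) ∧
      u = ∑ l, c l • a l ∧ C = ∑ l, vecMulVec (b l) (b l) ∧ v = ∑ l, c l • b l ∧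
      s = ∑ l, c l ^ 2 := by
  obtain ⟨k, G, hG, e⟩ := h
  refine ⟨k, fun l i => G (Sum.inl (Sum.inl i)) l, fun l j => G (Sum.inl (Sum.inr j)) l,
    fun l => G (Sum.inr ()) l, fun l i => hG _ _, fun l i => hG _ _, fun l => hG _ _,
    ?_, ?_, ?_, ?_, ?_, ?_⟩
  · ext i j
    simpa [borderedBlock, mul_apply, Matrix.sum_apply, vecMulVec_apply] using
      congrFun (congrFun e (Sum.inl (Sum.inl i))) (Sum.inl (Sum.inl j))
  · ext i j
    simpa [borderedBlock, mul_apply, Matrix.sum_apply, vecMulVec_apply] using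
      congrFun (congrFun e (Sum.inl (Sum.inl i))) (Sum.inl (Sum.inr j))
  · ext i
    simpa [borderedBlock, mul_apply] using
      congrFun (congrFun e (Sum.inr ())) (Sum.inl (Sum.inl i))
  · ext i j
    simpa [borderedBlock, mul_apply, Matrix.sum_apply, vecMulVec_apply] using
      congrFun (congrFun e (Sum.inl (Sum.inr i))) (Sum.inl (Sum.inr j))
  · ext i
    simpa [borderedBlock, mul_apply] using
      congrFun (congrFun e (Sum.inr ())) (Sum.inl (Sum.inr i))
  · simpa [borderedBlock, mul_apply, sq] using congrFun (congrFun e (Sum.inr ())) (Sum.inr ())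

theorem isCompletelyPositive_of_atoms {m n ι : Type*} [Fintype ι] (a : ι → m → ℝ)
    (b : ι → n → ℝ) (c : ι → ℝ) (ha : ∀ l, 0 ≤ a l) (hb : ∀ l, 0 ≤ b l) (hc : ∀ l, 0 ≤ c l) :
    IsCompletelyPositive (borderedBlock (∑ l, vecMulVec (a l) (a l)) (∑ l, vecMulVec (a l) (b l))
      (∑ l, c l • a l) (∑ l, vecMulVec (b l) (b l)) (∑ l, c l • b l) (∑ l, c l ^ 2)) := by
  let e := (Fintype.equivFin ι).symm
  refine ⟨Fintype.card ι, Matrix.of fun i l => Sum.elim (Sum.elim (a (e l)) (b (e l)))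
    (fun _ => c (e l)) i, ?_, ?_⟩
  · rintro ((i | i) | i) l
    · exact ha _ _
    · exact hb _ _
    · exact hc _
  · ext ((i | i) | i) ((j | j) | j) <;>
      simp only [borderedBlock, mul_apply, Matrix.sum_apply, vecMulVec_apply, fromBlocks_apply₁₁,
        fromBlocks_apply₁₂, fromBlocks_apply₂₁, fromBlocks_apply₂₂, transpose_apply, of_apply,
        Sum.elim_inl, Sum.elim_inr, replicateCol_apply, replicateRow_apply, Finset.sum_apply,
        Pi.smul_apply, smul_eq_mul, sq] <;>
      rw [← e.sum_comp] <;> simp only [mul_comm]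

theorem posSemidef_sum_vecMulVec_self {n ι : Type*} [Fintype n] [Fintype ι] (a : ι → n → ℝ) :
    (∑ l, vecMulVec (a l) (a l)).PosSemidef := by
  refine posSemidef_sum _ fun l _ => ?_
  simpa using posSemidef_vecMulVec_self_star (a l)

theorem two_mul_dotProduct_le {n : Type*} [Fintype n] (u v : n → ℝ) {t : ℝ} (ht : 0 < t) :
    2 * (u ⬝ᵥ v) ≤ t * (u ⬝ᵥ u) + t⁻¹ * (v ⬝ᵥ v) := by
  simp only [dotProduct, Finset.mul_sum, ← Finset.sum_add_distrib]
  refine Finset.sum_le_sum fun i _ => ?_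
  have h : t * (u i * u i) + t⁻¹ * (v i * v i) - 2 * (u i * v i) = t⁻¹ * (t * u i - v i) ^ 2 := by
    field_simp
    ring
  have : 0 ≤ t⁻¹ * (t * u i - v i) ^ 2 := by positivity
  linarith

theorem dotProduct_mulVec_self_le {m n : Type*} [Fintype m] [Fintype n] (A : Matrix m n ℝ)
    (a : n → ℝ) : (A *ᵥ a) ⬝ᵥ (A *ᵥ a) ≤ (∑ i, ∑ j, A i j ^ 2) * (a ⬝ᵥ a) := by
  rw [Finset.sum_mul]
  refine Finset.sum_le_sum fun i _ => ?_
  have := Finset.sum_mul_sq_le_sq_mul_sq Finset.univ (A i) a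
  simpa only [mulVec, dotProduct, ← sq] using this

/-! ### Constraint matrices as quadratic forms, and weak duality -/

namespace TwoStageDRLP

variable {N₁ N₂ K M J I : ℕ} (D : TwoStageDRLP N₁ N₂ K M J I)

/-- The residual `Q a - Wᵀ b`. -/
def residual (a : Fin K → ℝ) (b : Fin M ⊕ Fin J → ℝ) : Fin N₂ ⊕ Fin J → ℝ :=
  D.extQ *ᵥ a - D.extWᵀ *ᵥ b

/-- The part of the quadratic form of a constraint matrix of the copositive program that is
linear in the decision variables. -/
def linearForm (i : Fin I) (v : CopositiveVars N₂ J I) (a : Fin K → ℝ) (b : Fin M ⊕ Fin J → ℝ)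
    (c : ℝ) : ℝ :=
  v.lam * (a ⬝ᵥ a - 2 * c * ((D.sample i).ofLp ⬝ᵥ a)) +
    ∑ j, v.φ i j * D.residual a b j ^ 2 - c * (v.ψ i ⬝ᵥ D.residual a b) + v.s i * c ^ 2

/-- The objective of the completely positive program at a single atom. -/
def dualForm (x : Fin N₁ → ℝ) (δ : ℝ) (a : Fin K → ℝ) (b : Fin M ⊕ Fin J → ℝ) (c : ℝ) : ℝ :=
  b ⬝ᵥ (D.extT x *ᵥ a) + c * (D.exth x ⬝ᵥ b) - δ * (b ⬝ᵥ b)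

/-- The three blocks containing `diagonal (v.φ i)` are the expansion of the weighted square of `extQ
a - extWᵀ b`, and the `ψ` terms pair with the same residual. What remains free of the variables is
`dualForm`. -/
theorem dotProduct_copositiveMatrix_mulVec (x : Fin N₁ → ℝ) (δ : ℝ) (v : CopositiveVars N₂ J I)
    (i : Fin I) (a : Fin K → ℝ) (b : Fin M ⊕ Fin J → ℝ) (c : ℝ) :
    Sum.elim (Sum.elim a b) (fun _ => c) ⬝ᵥ
      (D.copositiveMatrix x δ v i *ᵥ Sum.elim (Sum.elim a b) fun _ => c) =
    D.linearForm i v a b c - D.dualForm x δ a b c := by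
  have hq : ∀ (u w : Fin N₂ ⊕ Fin J → ℝ),
      u ⬝ᵥ (diagonal (v.φ i) *ᵥ w) = ∑ j, v.φ i j * (u j * w j) :=
    fun u w => by
      simp only [dotProduct, mulVec_diagonal]
      exact Finset.sum_congr rfl fun j _ => by ring
  have h1 : a ⬝ᵥ ((v.lam • (1 : Matrix (Fin K) (Fin K) ℝ) +
      D.extQᵀ * Matrix.diagonal (v.φ i) * D.extQ) *ᵥ a) =
      v.lam * (a ⬝ᵥ a) + ∑ j, v.φ i j * ((D.extQ *ᵥ a) j * (D.extQ *ᵥ a) j) := by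
    rw [← hq, add_mulVec, smul_mulVec, one_mulVec, dotProduct_add, dotProduct_smul, smul_eq_mul,
      Matrix.mul_assoc, ← mulVec_mulVec, ← mulVec_mulVec, dotProduct_mulVec, vecMul_transpose]
  have h2 : a ⬝ᵥ ((-((1 / 2 : ℝ) • (D.extT x)ᵀ) -
      D.extQᵀ * Matrix.diagonal (v.φ i) * D.extWᵀ) *ᵥ b) =
      -(1 / 2) * (b ⬝ᵥ (D.extT x *ᵥ a)) -
        ∑ j, v.φ i j * ((D.extQ *ᵥ a) j * (D.extWᵀ *ᵥ b) j) := by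
    rw [← hq, sub_mulVec, neg_mulVec, smul_mulVec, dotProduct_sub, dotProduct_neg,
      dotProduct_smul, smul_eq_mul, Matrix.mul_assoc, ← mulVec_mulVec, ← mulVec_mulVec,
      dotProduct_mulVec a D.extQᵀ, vecMul_transpose, mulVec_transpose, dotProduct_comm a,
      ← dotProduct_mulVec]
    ring
  have h3 : b ⬝ᵥ ((D.extW * Matrix.diagonal (v.φ i) * D.extWᵀ +
      δ • (1 : Matrix (Fin M ⊕ Fin J) (Fin M ⊕ Fin J) ℝ)) *ᵥ b) =
      ∑ j, v.φ i j * ((D.extWᵀ *ᵥ b) j * (D.extWᵀ *ᵥ b) j) + δ * (b ⬝ᵥ b) := by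
    rw [← hq, add_mulVec, smul_mulVec, one_mulVec, dotProduct_add, dotProduct_smul, smul_eq_mul,
      Matrix.mul_assoc, ← mulVec_mulVec, ← mulVec_mulVec, dotProduct_mulVec b D.extW,
      mulVec_transpose D.extW]
  have h4 : (-(v.lam • (D.sample i).ofLp) - (1 / 2 : ℝ) • (D.extQᵀ *ᵥ v.ψ i)) ⬝ᵥ a =
      -(v.lam * ((D.sample i).ofLp ⬝ᵥ a)) - 1 / 2 * (v.ψ i ⬝ᵥ (D.extQ *ᵥ a)) := by
    rw [sub_dotProduct, neg_dotProduct, smul_dotProduct, smul_dotProduct, smul_eq_mul, smul_eq_mul,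
      mulVec_transpose, ← dotProduct_mulVec]
  have h5 : ((1 / 2 : ℝ) • (D.extW *ᵥ v.ψ i - D.exth x)) ⬝ᵥ b =
      1 / 2 * (v.ψ i ⬝ᵥ (D.extWᵀ *ᵥ b) - D.exth x ⬝ᵥ b) := by
    rw [smul_dotProduct, smul_eq_mul, sub_dotProduct, dotProduct_mulVec, vecMul_transpose]
  rw [copositiveMatrix, dotProduct_borderedBlock_mulVec, h1, h2, h3, h4, h5]
  have h6 : ∑ j, v.φ i j * D.residual a b j ^ 2 =
      ∑ j, v.φ i j * ((D.extQ *ᵥ a) j * (D.extQ *ᵥ a) j) -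
        2 * ∑ j, v.φ i j * ((D.extQ *ᵥ a) j * (D.extWᵀ *ᵥ b) j) +
        ∑ j, v.φ i j * ((D.extWᵀ *ᵥ b) j * (D.extWᵀ *ᵥ b) j) := by
    rw [Finset.mul_sum, ← Finset.sum_sub_distrib, ← Finset.sum_add_distrib]
    refine Finset.sum_congr rfl fun j _ => ?_
    simp only [residual, Pi.sub_apply]
    ring
  have h7 : v.ψ i ⬝ᵥ D.residual a b = v.ψ i ⬝ᵥ (D.extQ *ᵥ a) - v.ψ i ⬝ᵥ (D.extWᵀ *ᵥ b) := by
    rw [residual, dotProduct_sub]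
  rw [linearForm, dualForm, h6, h7]
  ring

theorem isSymm_copositiveMatrix (x : Fin N₁ → ℝ) (δ : ℝ) (v : CopositiveVars N₂ J I)
    (i : Fin I) : (D.copositiveMatrix x δ v i).IsSymm := by
  refine isSymm_borderedBlock ?_ _ _ ?_ _ _
  · simp [Matrix.IsSymm, transpose_mul, Matrix.mul_assoc]
  · simp [Matrix.IsSymm, transpose_mul, Matrix.mul_assoc]

theorem isCopositive_copositiveMatrix_iff (x : Fin N₁ → ℝ) (δ : ℝ) (v : CopositiveVars N₂ J I)
    (i : Fin I) : IsCopositive (D.copositiveMatrix x δ v i) ↔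
      ∀ (a : Fin K → ℝ) (b : Fin M ⊕ Fin J → ℝ) (c : ℝ), 0 ≤ a → 0 ≤ b → 0 ≤ c →
        D.dualForm x δ a b c ≤ D.linearForm i v a b c := by
  constructor
  · intro h a b c ha hb hc
    have := h.2 (Sum.elim (Sum.elim a b) fun _ => c) (by
      rintro ((j | j) | j)
      exacts [ha j, hb j, hc])
    rwa [dotProduct_copositiveMatrix_mulVec, sub_nonneg] at this
  · refine fun h => ⟨D.isSymm_copositiveMatrix x δ v i, fun z hz => ?_⟩
    have e : z = Sum.elim (Sum.elim (fun j => z (Sum.inl (Sum.inl j)))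
        (fun j => z (Sum.inl (Sum.inr j)))) fun _ => z (Sum.inr ()) := by
      ext ((j | j) | j) <;> rfl
    rw [e, dotProduct_copositiveMatrix_mulVec, sub_nonneg]
    exact h _ _ _ (fun j => hz _) (fun j => hz _) (hz _)

section Atoms

variable {ι : Type*} [Fintype ι] (a : ι → Fin K → ℝ) (b : ι → Fin M ⊕ Fin J → ℝ) (c : ι → ℝ)

theorem sum_residual_sq (j : Fin N₂ ⊕ Fin J) :
    ∑ l, D.residual (a l) (b l) j ^ 2 =
      D.extQ j ⬝ᵥ ((∑ l, vecMulVec (a l) (a l)) *ᵥ D.extQ j) -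
        2 * (D.extQ j ⬝ᵥ ((∑ l, vecMulVec (a l) (b l)) *ᵥ D.extW.col j)) +
        D.extW.col j ⬝ᵥ ((∑ l, vecMulVec (b l) (b l)) *ᵥ D.extW.col j) := by
  simp only [Matrix.sum_mulVec, dotProduct_sum, Finset.mul_sum, ← Finset.sum_sub_distrib,
    ← Finset.sum_add_distrib, vecMulVec_mulVec]
  refine Finset.sum_congr rfl fun l _ => ?_
  have h1 : (D.extQ *ᵥ a l) j = D.extQ j ⬝ᵥ a l := rfl
  have h2 : (D.extWᵀ *ᵥ b l) j = D.extW.col j ⬝ᵥ b l := rfl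
  simp only [residual, Pi.sub_apply, h1, h2, dotProduct_smul, MulOpposite.smul_eq_mul_unop,
    MulOpposite.unop_op, dotProduct_comm (a l), dotProduct_comm (b l)]
  ring

theorem sum_smul_residual : ∑ l, c l • D.residual (a l) (b l) =
    D.extQ *ᵥ (∑ l, c l • a l) - D.extWᵀ *ᵥ (∑ l, c l • b l) := by
  simp only [residual, mulVec_sum, mulVec_smul, smul_sub, Finset.sum_sub_distrib]

theorem sum_linearForm (i : Fin I) (v : CopositiveVars N₂ J I) :
    ∑ l, D.linearForm i v (a l) (b l) (c l) =
      v.lam * ((∑ l, vecMulVec (a l) (a l)).trace -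
        2 * ((D.sample i).ofLp ⬝ᵥ ∑ l, c l • a l)) +
      ∑ j, v.φ i j * (∑ l, D.residual (a l) (b l) j ^ 2) -
      v.ψ i ⬝ᵥ (D.extQ *ᵥ (∑ l, c l • a l) - D.extWᵀ *ᵥ (∑ l, c l • b l)) +
      v.s i * ∑ l, c l ^ 2 := by
  rw [← sum_smul_residual]
  simp only [linearForm, Finset.sum_add_distrib, Finset.sum_sub_distrib, trace_sum,
    trace_vecMulVec, dotProduct_sum, dotProduct_smul, smul_eq_mul, Finset.mul_sum, mul_sub]
  rw [Finset.sum_comm]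
  congr 4
  exact Finset.sum_congr rfl fun l _ => by ring

theorem sum_dualForm (x : Fin N₁ → ℝ) (δ : ℝ) :
    ∑ l, D.dualForm x δ (a l) (b l) (c l) =
      (D.extT x * ∑ l, vecMulVec (a l) (b l)).trace + D.exth x ⬝ᵥ (∑ l, c l • b l) -
        δ * (∑ l, vecMulVec (b l) (b l)).trace := by
  simp only [dualForm, Finset.sum_add_distrib, Finset.sum_sub_distrib, Matrix.mul_sum, trace_sum,
    mul_vecMulVec, trace_vecMulVec, dotProduct_sum, dotProduct_smul, smul_eq_mul, Finset.mul_sum,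
    dotProduct_comm (b _) (D.extT x *ᵥ _)]

end Atoms

theorem norm_sample_sq (i : Fin I) :
    ‖D.sample i‖ ^ 2 = (D.sample i).ofLp ⬝ᵥ (D.sample i).ofLp := by
  rw [EuclideanSpace.real_norm_sq_eq]
  simp only [dotProduct, sq]

/-- The constraints of the completely positive program force every atom of a feasible point to
satisfy the homogenized dual constraints. -/
theorem CompletelyPositiveFeasible.exists_atoms {D : TwoStageDRLP N₁ N₂ K M J I}
    {v : CompletelyPositiveVars K M J I} (hv : D.CompletelyPositiveFeasible v) (i : Fin I) :
    ∃ (k : ℕ) (a : Fin k → Fin K → ℝ) (b : Fin k → Fin M ⊕ Fin J → ℝ) (c : Fin k → ℝ),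
      (∀ l, 0 ≤ a l) ∧ (∀ l, 0 ≤ b l) ∧ (∀ l, 0 ≤ c l) ∧ ∑ l, c l ^ 2 = 1 ∧
      (∀ l, D.residual (a l) (b l) = -(c l • D.extq)) ∧
      v.Ω i = ∑ l, vecMulVec (a l) (a l) ∧ v.Y i = ∑ l, vecMulVec (a l) (b l) ∧
      v.μ i = ∑ l, c l • a l ∧ v.Γ i = ∑ l, vecMulVec (b l) (b l) ∧
      v.γ i = ∑ l, c l • b l := by
  obtain ⟨k, a, b, c, ha, hb, hc, hΩ, hY, hμ, hΓ, hγ, hs⟩ :=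
    (hv.completelyPositive i).exists_atoms
  refine ⟨k, a, b, c, ha, hb, hc, hs.symm, fun l => ?_, hΩ, hY, hμ, hΓ, hγ⟩
  ext j
  have hquad := hv.quadratic i j
  rw [hΩ, hY, hΓ, ← sum_residual_sq] at hquad
  have hlin : (∑ l, c l • D.residual (a l) (b l)) j = -D.extq j := by
    have := congrFun (hv.linear i) j
    rw [Pi.add_apply] at this
    rw [sum_smul_residual, ← hμ, ← hγ, Pi.sub_apply]
    linarith
  simp only [Finset.sum_apply, Pi.smul_apply, smul_eq_mul] at hlin
  -- Equality case of Cauchy–Schwarz: writing `r` and `q` for the `j`-th entries of the residual and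
  -- of `extq`, the constraints say `∑ r² = q²`, `∑ c r = -q` and `∑ c² = 1`.
  have hzero : ∑ l, (D.residual (a l) (b l) j + c l * D.extq j) ^ 2 = 0 := by
    have e : ∀ l, (D.residual (a l) (b l) j + c l * D.extq j) ^ 2 =
        D.residual (a l) (b l) j ^ 2 + 2 * D.extq j * (c l * D.residual (a l) (b l) j) +
          D.extq j ^ 2 * c l ^ 2 := fun l => by ring
    simp only [e, Finset.sum_add_distrib, ← Finset.mul_sum, hquad, hlin, ← hs]
    ring
  have := (Finset.sum_eq_zero_iff_of_nonneg fun l _ => sq_nonneg _).mp hzero l (Finset.mem_univ l)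
  have := pow_eq_zero_iff (two_ne_zero) |>.mp this
  simp only [Pi.neg_apply, Pi.smul_apply, smul_eq_mul]
  linarith

/-- Weak duality of the copositive and the completely positive program. -/
theorem completelyPositiveObjective_le_copositiveObjective (x : Fin N₁ → ℝ) (δ : ℝ)
    {v : CompletelyPositiveVars K M J I} (hv : D.CompletelyPositiveFeasible v)
    {w : CopositiveVars N₂ J I} (hlam : 0 ≤ w.lam)
    (hw : ∀ i, IsCopositive (D.copositiveMatrix x δ w i)) :
    D.completelyPositiveObjective x δ v ≤ D.copositiveObjective w := by
  have key : ∀ i, (D.extT x * v.Y i).trace + D.exth x ⬝ᵥ v.γ i - δ * (v.Γ i).trace ≤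
      (w.s i + D.extq ⬝ᵥ w.ψ i - w.lam * ‖D.sample i‖ ^ 2 + ∑ j, w.φ i j * D.extq j ^ 2) +
        w.lam * ((v.Ω i).trace - 2 * ((D.sample i).ofLp ⬝ᵥ v.μ i) +
          (D.sample i).ofLp ⬝ᵥ (D.sample i).ofLp) := by
    intro i
    obtain ⟨k, a, b, c, ha, hb, hc, hs, -, hΩ, hY, hμ, hΓ, hγ⟩ := hv.exists_atoms i
    have h1 : ∑ l, D.dualForm x δ (a l) (b l) (c l) ≤ ∑ l, D.linearForm i w (a l) (b l) (c l) :=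
      Finset.sum_le_sum fun l _ => (D.isCopositive_copositiveMatrix_iff x δ w i).mp (hw i) _ _ _
        (ha l) (hb l) (hc l)
    have hquad : ∀ j, ∑ l, D.residual (a l) (b l) j ^ 2 = D.extq j ^ 2 := fun j => by
      rw [sum_residual_sq, ← hΩ, ← hY, ← hΓ, hv.quadratic i j]
    have hlin : D.extQ *ᵥ v.μ i - D.extWᵀ *ᵥ v.γ i = -D.extq := by
      rw [← hv.linear i]
      abel
    rw [sum_dualForm, sum_linearForm, ← hΩ, ← hY, ← hμ, ← hΓ, ← hγ, hlin, hs,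
      dotProduct_neg, dotProduct_comm] at h1
    simp only [hquad] at h1
    rw [norm_sample_sq]
    rw [dotProduct_comm (w.ψ i)] at h1
    rw [dotProduct_comm (D.exth x)]
    linarith
  have hsum := Finset.sum_le_sum fun i (_ : i ∈ Finset.univ) => key i
  rw [Finset.sum_add_distrib, ← Finset.mul_sum] at hsum
  have h2 := mul_le_mul_of_nonneg_left hv.radius_bound hlam
  have hI : 0 ≤ 1 / (I : ℝ) := by positivity
  have h3 := mul_le_mul_of_nonneg_left hsum hI
  rw [completelyPositiveObjective, copositiveObjective]
  linarith

/-! ### Slater point and strong duality -/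

/-- For `δ > 0`, the perturbed copositive program satisfies the Slater condition. -/
theorem exists_slater (x : Fin N₁ → ℝ) {δ : ℝ} (hδ : 0 < δ) :
    ∃ v : CopositiveVars N₂ J I, 0 < v.lam ∧ ∀ i a b c, (a, b, c) ≠ 0 →
      D.dualForm x δ a b c < D.linearForm i v a b c := by
  let τ := ∑ i, ∑ j, D.extT x i j ^ 2
  have hτ : 0 ≤ τ := Finset.sum_nonneg fun i _ => Finset.sum_nonneg fun j _ => sq_nonneg _
  let lam := 2 * (δ⁻¹ * τ + 1)
  have hlam : 0 < lam := by positivity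
  -- The three cross terms are split by Young's inequality. Two of them use up half of `δ‖b‖²`, the
  -- sample term half of `lam * ‖a‖²`, and these constants leave the margin `‖a‖² + (δ / 2)‖b‖² +
  -- c²` of `hpos`.
  refine ⟨⟨lam, fun i => 2 * lam * ((D.sample i).ofLp ⬝ᵥ (D.sample i).ofLp) +
    δ⁻¹ * (D.exth x ⬝ᵥ D.exth x) + 1, 0, 0⟩, hlam, fun i a b c h => ?_⟩
  have h1 := two_mul_dotProduct_le b (D.extT x *ᵥ a) (t := δ / 2) (by positivity)
  have h2 := two_mul_dotProduct_le b (c • D.exth x) (t := δ / 2) (by positivity)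
  have h3 := two_mul_dotProduct_le a (c • (D.sample i).ofLp) (t := 1 / 2) (by positivity)
  have h4 := dotProduct_mulVec_self_le (D.extT x) a
  simp only [dotProduct_smul, smul_dotProduct, smul_eq_mul] at h2 h3
  rw [dotProduct_comm b] at h2
  rw [dotProduct_comm a] at h3
  have ha : 0 ≤ a ⬝ᵥ a := Finset.sum_nonneg fun j _ => mul_self_nonneg (a j)
  have hb : 0 ≤ b ⬝ᵥ b := Finset.sum_nonneg fun j _ => mul_self_nonneg (b j)
  have hpos : 0 < a ⬝ᵥ a + δ / 2 * (b ⬝ᵥ b) + c ^ 2 := by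
    by_contra hle
    have hc := sq_nonneg c
    have hb' : 0 ≤ δ / 2 * (b ⬝ᵥ b) := by positivity
    refine h ?_
    have ea : a ⬝ᵥ a = 0 := by linarith
    have eb : δ / 2 * (b ⬝ᵥ b) = 0 := by linarith
    have ec : c ^ 2 = 0 := by linarith
    have eb' : b ⬝ᵥ b = 0 := by
      rcases mul_eq_zero.mp eb with h | h
      · linarith
      · exact h
    rw [dotProduct_self_eq_zero] at ea eb'
    rw [ea, eb', pow_eq_zero_iff two_ne_zero |>.mp ec]
    rfl
  have h5 : δ⁻¹ * ((D.extT x *ᵥ a) ⬝ᵥ (D.extT x *ᵥ a)) ≤ δ⁻¹ * (τ * (a ⬝ᵥ a)) :=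
    mul_le_mul_of_nonneg_left h4 (by positivity)
  have h6 := mul_le_mul_of_nonneg_left h3 hlam.le
  have e : (δ / 2)⁻¹ = 2 * δ⁻¹ := by field_simp
  rw [e] at h1 h2
  have e2 : lam * (a ⬝ᵥ a) = 2 * (δ⁻¹ * (τ * (a ⬝ᵥ a))) + 2 * (a ⬝ᵥ a) := by
    simp only [lam]
    ring
  norm_num at h6
  simp only [linearForm, dualForm, Pi.zero_apply, zero_mul, Finset.sum_const_zero,
    zero_dotProduct, mul_zero, sub_zero, add_zero]
  nlinarith

theorem copositiveValue_ne_top (x : Fin N₁ → ℝ) {δ : ℝ} (hδ : 0 < δ) :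
    D.copositiveValue δ x ≠ ⊤ := by
  obtain ⟨v, hlam, hv⟩ := D.exists_slater x hδ
  refine ne_top_of_le_ne_top (EReal.coe_ne_top (D.copositiveObjective v))
    (iInf₂_le v ⟨hlam.le, fun i => ?_⟩)
  rw [isCopositive_copositiveMatrix_iff]
  intro a b c _ _ _
  by_cases h : (a, b, c) = 0
  · simp only [Prod.mk_eq_zero] at h
    obtain ⟨rfl, rfl, rfl⟩ := h
    simp [linearForm, dualForm, residual]
  · exact (hv i a b c h).le

theorem residual_smul (t : ℝ) (a : Fin K → ℝ) (b : Fin M ⊕ Fin J → ℝ) :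
    D.residual (t • a) (t • b) = t • D.residual a b := by
  simp only [residual, mulVec_smul, smul_sub]

theorem linearForm_smul (i : Fin I) (v : CopositiveVars N₂ J I) (t : ℝ) (a : Fin K → ℝ)
    (b : Fin M ⊕ Fin J → ℝ) (c : ℝ) :
    D.linearForm i v (t • a) (t • b) (t • c) = t ^ 2 * D.linearForm i v a b c := by
  simp only [linearForm, residual_smul, dotProduct_smul, smul_dotProduct, smul_eq_mul, Pi.smul_apply, mul_add,
    mul_sub, Finset.mul_sum]
  have : ∀ j, v.φ i j * (t * D.residual a b j) ^ 2 = t ^ 2 * (v.φ i j * D.residual a b j ^ 2) :=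
    fun j => by ring
  simp only [this]
  ring

theorem dualForm_smul (x : Fin N₁ → ℝ) (δ t : ℝ) (a : Fin K → ℝ) (b : Fin M ⊕ Fin J → ℝ) (c : ℝ) :
    D.dualForm x δ (t • a) (t • b) (t • c) = t ^ 2 * D.dualForm x δ a b c := by
  simp only [dualForm, mulVec_smul, dotProduct_smul, smul_dotProduct, smul_eq_mul]
  ring

/-- Atoms that represent the objective of the copositive program by constraint functionals yield
a feasible point of the completely positive program. -/
theorem completelyPositiveFeasible_of_objective_eq {ι : Type*} [Fintype ι] (hI : 0 < I)
    (a : Fin I → ι → Fin K → ℝ) (b : Fin I → ι → Fin M ⊕ Fin J → ℝ) (c : Fin I → ι → ℝ)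
    (ha : ∀ i l, 0 ≤ a i l) (hb : ∀ i l, 0 ≤ b i l) (hc : ∀ i l, 0 ≤ c i l) (ω : ℝ) (hω : 0 ≤ ω)
    (h : ∀ v : CopositiveVars N₂ J I, D.copositiveObjective v =
      (1 / (I : ℝ)) * ∑ i, ∑ l, D.linearForm i v (a i l) (b i l) (c i l) + ω * v.lam) :
    D.CompletelyPositiveFeasible
      { γ := fun i => ∑ l, c i l • b i l
        μ := fun i => ∑ l, c i l • a i l
        Γ := fun i => ∑ l, vecMulVec (b i l) (b i l)
        Ω := fun i => ∑ l, vecMulVec (a i l) (a i l)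
        Y := fun i => ∑ l, vecMulVec (a i l) (b i l) } := by
  have hI' : 1 / (I : ℝ) ≠ 0 := by positivity
  simp only [sum_linearForm, copositiveObjective] at h
  -- The identity `h` is tested on coordinate directions: `s` gives the normalization, `ψ` the
  -- linear and `φ` the quadratic constraints, and `lam` the radius bound with slack `ω`.
  have hs : ∀ i, ∑ l, c i l ^ 2 = 1 := fun i => by
    have := h ⟨0, Pi.single i 1, 0, 0⟩
    simp only [Pi.single_apply, Pi.zero_apply, zero_mul, mul_zero, Finset.sum_const_zero,
      dotProduct_zero, zero_dotProduct, add_zero, sub_zero, zero_add, ite_mul, one_mul,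
      Finset.sum_ite_eq', Finset.mem_univ, if_true] at this
    exact (mul_left_cancel₀ hI' this).symm
  refine ⟨fun i => Finset.sum_nonneg fun l _ => smul_nonneg (hc i l) (hb i l),
    fun i => Finset.sum_nonneg fun l _ => smul_nonneg (hc i l) (ha i l),
    fun i => posSemidef_sum_vecMulVec_self _, fun i => posSemidef_sum_vecMulVec_self _,
    fun i => ?_, fun i j => ?_, ?_, fun i => ?_⟩
  · ext j
    have := h ⟨0, 0, Pi.single i (Pi.single j 1), 0⟩
    simp only [Pi.zero_apply, zero_mul, mul_zero, Finset.sum_const_zero, add_zero, sub_zero,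
      zero_add, zero_sub, Finset.sum_neg_distrib] at this
    have e := mul_left_cancel₀ hI' this
    rw [Finset.sum_eq_single i (fun i' _ hi' => by simp [hi']) (by simp),
      Finset.sum_eq_single i (fun i' _ hi' => by simp [hi']) (by simp)] at e
    simp only [Pi.single_eq_same, dotProduct_single, single_dotProduct, mul_one, one_mul,
      Pi.sub_apply] at e
    rw [Pi.add_apply]
    linarith
  · have := h ⟨0, 0, 0, Pi.single i (Pi.single j 1)⟩
    simp only [Pi.zero_apply, zero_mul, mul_zero, add_zero, sub_zero,
      zero_add, dotProduct_zero, zero_dotProduct] at this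
    have e := mul_left_cancel₀ hI' this
    rw [Finset.sum_eq_single i (fun i' _ hi' => by simp [hi']) (by simp),
      Finset.sum_eq_single i (fun i' _ hi' => by simp [hi']) (by simp)] at e
    simp only [Pi.single_eq_same, Pi.single_apply, ite_mul, one_mul, zero_mul, Finset.sum_ite_eq',
      Finset.mem_univ, if_true] at e
    rw [e, sum_residual_sq]
  · have := h ⟨1, 0, 0, 0⟩
    simp only [Pi.zero_apply, zero_mul, add_zero, sub_zero, zero_sub, one_mul, mul_one,
      dotProduct_zero, zero_dotProduct, Finset.sum_const_zero, norm_sample_sq,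
      Finset.sum_neg_distrib] at this
    rw [Finset.sum_add_distrib]
    linarith
  · have := isCompletelyPositive_of_atoms (a i) (b i) (c i) (ha i) (hb i) (hc i)
    rwa [hs] at this

/-- The decision variables of the copositive program as a vector space. -/
abbrev VarSpace (N₂ J I : ℕ) : Type :=
  ℝ × (Fin I → ℝ) × (Fin I → Fin N₂ ⊕ Fin J → ℝ) × (Fin I → Fin N₂ ⊕ Fin J → ℝ)

/-- The decision variables of the copositive program with given coordinates. -/
def VarSpace.toVars (e : VarSpace N₂ J I) : CopositiveVars N₂ J I := ⟨e.1, e.2.1, e.2.2.1, e.2.2.2⟩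

/-- The index set of the rows of the constraint matrices. -/
abbrev AtomIndex (K M J : ℕ) : Type := (Fin K ⊕ (Fin M ⊕ Fin J)) ⊕ Unit

/-- `linearForm` at the three blocks of a vector. -/
def linearFormAt (i : Fin I) (v : CopositiveVars N₂ J I) (z : AtomIndex K M J → ℝ) : ℝ :=
  D.linearForm i v (fun j => z (Sum.inl (Sum.inl j))) (fun j => z (Sum.inl (Sum.inr j)))
    (z (Sum.inr ()))

/-- `dualForm` at the three blocks of a vector. -/
def dualFormAt (x : Fin N₁ → ℝ) (δ : ℝ) (z : AtomIndex K M J → ℝ) : ℝ :=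
  D.dualForm x δ (fun j => z (Sum.inl (Sum.inl j))) (fun j => z (Sum.inl (Sum.inr j)))
    (z (Sum.inr ()))

theorem linearFormAt_smul (i : Fin I) (v : CopositiveVars N₂ J I) (t : ℝ)
    (z : AtomIndex K M J → ℝ) : D.linearFormAt i v (t • z) = t ^ 2 * D.linearFormAt i v z :=
  D.linearForm_smul i v t _ _ _

theorem dualFormAt_smul (x : Fin N₁ → ℝ) (δ t : ℝ) (z : AtomIndex K M J → ℝ) :
    D.dualFormAt x δ (t • z) = t ^ 2 * D.dualFormAt x δ z :=
  D.dualForm_smul x δ t _ _ _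

theorem linearFormAt_zero (i : Fin I) (v : CopositiveVars N₂ J I) :
    D.linearFormAt i v 0 = 0 := by
  simpa using D.linearFormAt_smul i v 0 0

theorem dualFormAt_zero (x : Fin N₁ → ℝ) (δ : ℝ) : D.dualFormAt x δ 0 = 0 := by
  simpa using D.dualFormAt_smul x δ 0 0

theorem continuous_linearFormAt (i : Fin I) (v : CopositiveVars N₂ J I) :
    Continuous (D.linearFormAt i v) := by
  unfold linearFormAt
  simp only [linearForm, residual, dotProduct, mulVec, Pi.sub_apply]
  fun_prop

theorem continuous_dualFormAt (x : Fin N₁ → ℝ) (δ : ℝ) : Continuous (D.dualFormAt x δ) := by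
  unfold dualFormAt
  simp only [dualForm, dotProduct, mulVec]
  fun_prop

/-- `linearFormAt` as a linear map of the decision variables. -/
noncomputable def linearFormMap (i : Fin I) (z : AtomIndex K M J → ℝ) : VarSpace N₂ J I →ₗ[ℝ] ℝ where
  toFun e := D.linearFormAt i e.toVars z
  map_add' e f := by
    simp only [linearFormAt, linearForm, VarSpace.toVars, Prod.fst_add, Prod.snd_add, Pi.add_apply,
      add_mul, Finset.sum_add_distrib, add_dotProduct, mul_add]
    ring
  map_smul' t e := by
    simp only [linearFormAt, linearForm, VarSpace.toVars, Prod.smul_fst, Prod.smul_snd,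
      Pi.smul_apply, smul_eq_mul, smul_dotProduct, mul_assoc, ← Finset.mul_sum, RingHom.id_apply]
    ring

/-- The objective of the copositive program as a linear map of the decision variables. -/
noncomputable def objectiveMap : VarSpace N₂ J I →ₗ[ℝ] ℝ where
  toFun e := D.copositiveObjective e.toVars
  map_add' e f := by
    simp only [copositiveObjective, VarSpace.toVars, Prod.fst_add, Prod.snd_add, Pi.add_apply,
      add_mul, Finset.sum_add_distrib, dotProduct_add, Finset.sum_sub_distrib, mul_add, mul_sub]
    ring
  map_smul' t e := by
    simp only [copositiveObjective, VarSpace.toVars, Prod.smul_fst, Prod.smul_snd, Pi.smul_apply,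
      smul_eq_mul, dotProduct_smul, mul_assoc, ← Finset.mul_sum, RingHom.id_apply,
      ← mul_add, ← mul_sub]
    ring

/-- The constraints of the copositive program in terms of the standard simplex. -/
theorem isCopositive_copositiveMatrix_of_simplex (x : Fin N₁ → ℝ) (δ : ℝ)
    (v : CopositiveVars N₂ J I) (i : Fin I)
    (h : ∀ z ∈ stdSimplex ℝ (AtomIndex K M J), D.dualFormAt x δ z ≤ D.linearFormAt i v z) :
    IsCopositive (D.copositiveMatrix x δ v i) := by
  rw [isCopositive_copositiveMatrix_iff]
  intro a b s ha hb hs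
  let z : AtomIndex K M J → ℝ := Sum.elim (Sum.elim a b) fun _ => s
  change D.dualFormAt x δ z ≤ D.linearFormAt i v z
  have hz : ∀ j, 0 ≤ z j := by
    rintro ((j | j) | j)
    exacts [ha j, hb j, hs]
  have hr : 0 ≤ ∑ j, z j := Finset.sum_nonneg fun j _ => hz j
  rcases hr.eq_or_lt with h0 | h0
  · have hz0 : z = 0 := by
      ext j
      exact (Finset.sum_eq_zero_iff_of_nonneg fun j _ => hz j).mp h0.symm j (Finset.mem_univ j)
    rw [hz0, linearFormAt_zero, dualFormAt_zero]
  · have := h ((∑ j, z j)⁻¹ • z) ⟨fun j => mul_nonneg (inv_nonneg.mpr hr) (hz j), by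
      simp only [Pi.smul_apply, smul_eq_mul, ← Finset.mul_sum]
      exact inv_mul_cancel₀ h0.ne'⟩
    rw [linearFormAt_smul, dualFormAt_smul] at this
    exact le_of_mul_le_mul_left this (by positivity)

/-- Strong duality: a lower bound of the perturbed copositive program is attained by the
completely positive program. -/
theorem exists_completelyPositiveFeasible_ge (hI : 0 < I) (x : Fin N₁ → ℝ) {δ : ℝ} (hδ : 0 < δ)
    (m : ℝ) (hm : ∀ v : CopositiveVars N₂ J I,
      0 ≤ v.lam ∧ (∀ i, IsCopositive (D.copositiveMatrix x δ v i)) → m ≤ D.copositiveObjective v) :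
    ∃ v, D.CompletelyPositiveFeasible v ∧ m ≤ D.completelyPositiveObjective x δ v := by
  have : CompactSpace {z // z ∈ stdSimplex ℝ (AtomIndex K M J)} :=
    isCompact_iff_compactSpace.mp (isCompact_stdSimplex ℝ _)
  -- Homogeneity allows restricting the test vectors to the simplex, so the index set is compact.
  -- The `Unit` summand is the constraint `λ ≥ 0`.
  let g : (Fin I × {z // z ∈ stdSimplex ℝ (AtomIndex K M J)}) ⊕ Unit → VarSpace N₂ J I →L[ℝ] ℝ :=
    Sum.elim (fun p => LinearMap.toContinuousLinearMap (D.linearFormMap p.1 p.2.1))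
      (fun _ => ContinuousLinearMap.fst ℝ _ _)
  let β : (Fin I × {z // z ∈ stdSimplex ℝ (AtomIndex K M J)}) ⊕ Unit → ℝ :=
    Sum.elim (fun p => -D.dualFormAt x δ p.2.1) (fun _ => 0)
  have hgl : ∀ i z e, g (Sum.inl (i, z)) e = D.linearFormAt i e.toVars z.1 := fun _ _ _ => rfl
  have hgr : ∀ u e, g (Sum.inr u) e = e.1 := fun _ _ => rfl
  have hβl : ∀ i z, β (Sum.inl (i, z)) = -D.dualFormAt x δ z.1 := fun _ _ => rfl
  have hβr : ∀ u, β (Sum.inr u) = 0 := fun _ => rfl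
  have hg : ∀ e, Continuous fun θ => g θ e := fun e => by
    refine continuous_sum_dom.mpr ⟨?_, continuous_const⟩
    refine continuous_prod_of_discrete_left.mpr fun i => ?_
    exact (D.continuous_linearFormAt i e.toVars).comp continuous_subtype_val
  have hβ : Continuous β := by
    refine continuous_sum_dom.mpr ⟨?_, continuous_const⟩
    exact ((D.continuous_dualFormAt x δ).comp (continuous_subtype_val.comp continuous_snd)).neg
  obtain ⟨v₀, hlam₀, hv₀⟩ := D.exists_slater x hδ
  obtain ⟨ι, _, θ, w, hw, hobj, hbound⟩ := exists_multipliers_of_slater g β hg hβ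
    (LinearMap.toContinuousLinearMap D.objectiveMap) m (v₀.lam, v₀.s, v₀.ψ, v₀.φ)
    (by
      rintro (⟨i, z⟩ | u)
      · rw [hgl, hβl, ← sub_eq_add_neg, sub_pos]
        refine hv₀ i _ _ _ fun h0 => ?_
        simp only [Prod.mk_eq_zero] at h0
        have : z.1 = 0 := by
          ext ((j | j) | j)
          exacts [congrFun h0.1 j, congrFun h0.2.1 j, h0.2.2]
        have h1 := z.2.2
        rw [this] at h1
        simp at h1
      · rw [hgr, hβr, add_zero]
        exact hlam₀)
    (fun e he => by
      refine hm e.toVars ⟨?_, fun i => D.isCopositive_copositiveMatrix_of_simplex x δ _ i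
        fun z hz => ?_⟩
      · have := he (Sum.inr ())
        rwa [hgr, hβr, add_zero] at this
      · have := he (Sum.inl (i, ⟨z, hz⟩))
        rwa [hgl, hβl, ← sub_eq_add_neg, sub_nonneg] at this)
  have hI' : (0 : ℝ) < I := by exact_mod_cast hI
  -- The forms are quadratic, so a multiplier is absorbed into its test vector by a square root. The
  -- factor `I` cancels the averaging, and multipliers of other samples or of `λ ≥ 0` become zero
  -- atoms.
  let ζ : Fin I → ι → AtomIndex K M J → ℝ := fun i l => Sum.elim
    (fun p => if p.1 = i then √(I * w l) • p.2.1 else 0) (fun _ => 0) (θ l)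
  let ω : ι → ℝ := fun l => Sum.elim (fun _ => 0) (fun _ => w l) (θ l)
  have hζ : ∀ i l j, 0 ≤ ζ i l j := fun i l j => by
    simp only [ζ]
    rcases θ l with ⟨i', z⟩ | -
    · simp only [Sum.elim_inl]
      split_ifs
      · exact mul_nonneg (Real.sqrt_nonneg _) (z.2.1 j)
      · exact le_rfl
    · exact le_rfl
  have hlin : ∀ l (e : VarSpace N₂ J I), w l * g (θ l) e =
      (1 / (I : ℝ)) * ∑ i, D.linearFormAt i e.toVars (ζ i l) + ω l * e.1 := fun l e => by
    simp only [ζ, ω]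
    rcases θ l with ⟨i', z⟩ | u
    · simp only [Sum.elim_inl]
      rw [Finset.sum_eq_single i' (fun i _ hi => by
        rw [if_neg hi.symm, linearFormAt_zero]) (by simp), if_pos rfl, linearFormAt_smul,
        Real.sq_sqrt (mul_nonneg hI'.le (hw l)), hgl]
      field_simp
      ring
    · simp only [Sum.elim_inr, linearFormAt_zero, Finset.sum_const_zero, hgr]
      ring
  have hdual : ∀ l, w l * β (θ l) = -((1 / (I : ℝ)) * ∑ i, D.dualFormAt x δ (ζ i l)) := fun l => by
    simp only [ζ]
    rcases θ l with ⟨i', z⟩ | u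
    · simp only [Sum.elim_inl]
      rw [Finset.sum_eq_single i' (fun i _ hi => by
        rw [if_neg hi.symm, dualFormAt_zero]) (by simp), if_pos rfl, dualFormAt_smul,
        Real.sq_sqrt (mul_nonneg hI'.le (hw l)), hβl]
      field_simp
    · simp only [Sum.elim_inr, dualFormAt_zero, Finset.sum_const_zero, hβr]
      ring
  refine ⟨_, D.completelyPositiveFeasible_of_objective_eq hI
    (fun i l j => ζ i l (Sum.inl (Sum.inl j))) (fun i l j => ζ i l (Sum.inl (Sum.inr j)))
    (fun i l => ζ i l (Sum.inr ())) (fun i l j => hζ _ _ _) (fun i l j => hζ _ _ _)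
    (fun i l => hζ _ _ _) (∑ l, ω l) (Finset.sum_nonneg fun l _ => ?_) (fun v => ?_), ?_⟩
  · simp only [ω]
    rcases θ l with _ | -
    exacts [le_rfl, hw l]
  · have := hobj (v.lam, v.s, v.ψ, v.φ)
    simp only [hlin, Finset.sum_add_distrib, ← Finset.mul_sum, ← Finset.sum_mul] at this
    rw [Finset.sum_comm] at this
    exact this
  · simp only [hdual, Finset.sum_neg_distrib, neg_neg, ← Finset.mul_sum] at hbound
    rw [Finset.sum_comm] at hbound
    simpa only [completelyPositiveObjective, sum_dualForm, dualFormAt] using hbound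

end TwoStageDRLP

/-! ### Discrete distributions and the lower bound of the worst case -/

section DiscreteMeasure

variable {α ι : Type*} [MeasurableSpace α] [MeasurableSingletonClass α] [Fintype ι]

theorem lintegral_sum_ofReal_smul_dirac (w : ι → ℝ) (p : ι → α) (f : α → ℝ≥0∞) :
    ∫⁻ z, f z ∂(∑ l, ENNReal.ofReal (w l) • Measure.dirac (p l)) =
      ∑ l, ENNReal.ofReal (w l) * f (p l) := by
  simp [lintegral_finsetSum_measure, lintegral_smul_measure, lintegral_dirac]

/-- Integrals against Dirac masses need no measurability of `f`. The negative part of `f` is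
dominated by that of the real values `r`, so the difference defining the expectation is never `∞ -
∞`. -/
theorem le_extExpectation_sum_dirac {w : ι → ℝ} (hw : ∀ l, 0 ≤ w l) (p : ι → α)
    {f : α → EReal} {r : ι → ℝ} (hr : ∀ l, (r l : EReal) ≤ f (p l)) :
    ((∑ l, w l * r l : ℝ) : EReal) ≤
      extExpectation (∑ l, ENNReal.ofReal (w l) • Measure.dirac (p l)) f := by
  have hcoe : ∀ r : ι → ℝ, ∑ l, ENNReal.ofReal (w l) * ENNReal.ofReal (r l) =
      ENNReal.ofReal (∑ l, w l * max (r l) 0) := fun r => by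
    rw [ENNReal.ofReal_sum_of_nonneg fun l _ => mul_nonneg (hw l) (le_max_right _ _)]
    refine Finset.sum_congr rfl fun l _ => ?_
    rw [ENNReal.ofReal_mul (hw l)]
    congr 1
    rcases le_total (r l) 0 with h | h
    · rw [max_eq_right h, ENNReal.ofReal_of_nonpos h, ENNReal.ofReal_zero]
    · rw [max_eq_left h]
  have hnn : ∀ r : ι → ℝ, 0 ≤ ∑ l, w l * max (r l) 0 := fun r =>
    Finset.sum_nonneg fun l _ => mul_nonneg (hw l) (le_max_right _ _)
  have hsplit : ∑ l, w l * r l = ∑ l, w l * max (r l) 0 - ∑ l, w l * max (-r l) 0 := by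
    rw [← Finset.sum_sub_distrib]
    refine Finset.sum_congr rfl fun l _ => ?_
    rw [← mul_sub]
    congr 1
    rcases le_total (r l) 0 with h | h
    · rw [max_eq_right h, max_eq_left (by linarith)]
      ring
    · rw [max_eq_left h, max_eq_right (by linarith)]
      ring
  rw [hsplit, EReal.coe_sub, extExpectation, lintegral_sum_ofReal_smul_dirac,
    lintegral_sum_ofReal_smul_dirac]
  refine EReal.sub_le_sub ?_ ?_
  · have : ∑ l, ENNReal.ofReal (w l) * ENNReal.ofReal (r l) ≤
        ∑ l, ENNReal.ofReal (w l) * (f (p l)).toENNReal := by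
      gcongr with l
      exact EReal.toENNReal_le_toENNReal (hr l)
    rw [hcoe] at this
    refine le_trans (le_of_eq ?_) (EReal.coe_ennreal_le_coe_ennreal_iff.mpr this)
    rw [EReal.coe_ennreal_ofReal, max_eq_left (hnn r)]
  · have : ∑ l, ENNReal.ofReal (w l) * (-f (p l)).toENNReal ≤
        ∑ l, ENNReal.ofReal (w l) * ENNReal.ofReal (-r l) := by
      gcongr with l
      refine EReal.toENNReal_le_toENNReal (y := ((-r l : ℝ) : EReal)) ?_
      rw [EReal.coe_neg]
      exact EReal.neg_le_neg_iff.mpr (hr l)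
    rw [hcoe] at this
    refine (EReal.coe_ennreal_le_coe_ennreal_iff.mpr this).trans (le_of_eq ?_)
    rw [EReal.coe_ennreal_ofReal, max_eq_left (hnn _)]

end DiscreteMeasure

namespace TwoStageDRLP

variable {N₁ N₂ K M J I : ℕ} (D : TwoStageDRLP N₁ N₂ K M J I)

theorem residual_add (a a' : Fin K → ℝ) (b b' : Fin M ⊕ Fin J → ℝ) :
    D.residual (a + a') (b + b') = D.residual a b + D.residual a' b' := by
  simp only [residual, mulVec_add]
  abel

/-- The rows from `S` define `σ` as a slack. Nonnegativity of the combined vector therefore encodes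
both dual feasibility of `p` and the inequality `S ξ ≤ t`. -/
theorem residual_sumElim_eq_neg_extq_iff (ξ : Fin K → ℝ) (p : Fin M → ℝ) (σ : Fin J → ℝ) :
    D.residual ξ (Sum.elim p σ) = -D.extq ↔ D.Q *ᵥ ξ + D.q = D.Wᵀ *ᵥ p ∧ σ = D.t - D.S *ᵥ ξ := by
  have h1 : D.residual ξ (Sum.elim p σ) =
      Sum.elim (D.Q *ᵥ ξ - D.Wᵀ *ᵥ p) (D.S *ᵥ ξ + σ) := by
    ext (j | j) <;>
      simp [residual, extQ, extW, fromRows_mulVec, fromBlocks_transpose, fromBlocks_mulVec,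
        neg_mulVec]
  have h2 : -D.extq = Sum.elim (-D.q) D.t := by
    ext (j | j) <;> simp [extq]
  rw [h1, h2, Sum.elim_eq_iff]
  refine and_congr ⟨fun h => ?_, fun h => ?_⟩ ⟨fun h => ?_, fun h => ?_⟩
  · rw [← sub_eq_zero, ← sub_eq_zero.mpr h]
    abel
  · rw [← sub_eq_zero, ← sub_eq_zero.mpr h]
    abel
  · rw [← h]
    abel
  · rw [h]
    abel

theorem dualForm_zero_sumElim (x : Fin N₁ → ℝ) (ξ : Fin K → ℝ) (p : Fin M → ℝ) (σ : Fin J → ℝ) :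
    D.dualForm x 0 ξ (Sum.elim p σ) 1 = (D.T x *ᵥ ξ + D.h x) ⬝ᵥ p := by
  simp only [dualForm, extT, exth, fromRows_mulVec, sumElim_dotProduct_sumElim, zero_mulVec,
    dotProduct_zero, zero_dotProduct, add_dotProduct, dotProduct_comm p]
  ring

/-- Weak duality of the recourse problem. -/
theorem dualForm_le_recourse (x : Fin N₁ → ℝ) (ξ : EuclideanSpace ℝ (Fin K))
    {b : Fin M ⊕ Fin J → ℝ} (hb : 0 ≤ b) (h : D.residual ξ.ofLp b = -D.extq) :
    ((D.dualForm x 0 ξ.ofLp b 1 : ℝ) : EReal) ≤ D.recourse x ξ := by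
  obtain ⟨p, σ, rfl⟩ : ∃ p σ, b = Sum.elim p σ := ⟨b ∘ Sum.inl, b ∘ Sum.inr, by simp⟩
  refine le_iInf₂ fun y hy => EReal.coe_le_coe_iff.mpr ?_
  rw [dualForm_zero_sumElim, ((D.residual_sumElim_eq_neg_extq_iff _ _ _).mp h).1, mulVec_transpose,
    ← dotProduct_mulVec, dotProduct_comm p]
  exact dotProduct_le_dotProduct_of_nonneg_right hy fun m => hb (Sum.inl m)

theorem mem_support_of_residual_eq (ξ : EuclideanSpace ℝ (Fin K)) (hξ : 0 ≤ ξ.ofLp)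
    {b : Fin M ⊕ Fin J → ℝ} (hb : 0 ≤ b) (h : D.residual ξ.ofLp b = -D.extq) :
    ξ ∈ D.support := by
  obtain ⟨p, σ, rfl⟩ : ∃ p σ, b = Sum.elim p σ := ⟨b ∘ Sum.inl, b ∘ Sum.inr, by simp⟩
  refine ⟨hξ, sub_nonneg.mp ?_⟩
  rw [← ((D.residual_sumElim_eq_neg_extq_iff _ _ _).mp h).2]
  exact fun j => hb (Sum.inr j)

theorem SufficientlyExpensiveRecourse.exists_residual_eq {D : TwoStageDRLP N₁ N₂ K M J I}
    (h : D.SufficientlyExpensiveRecourse) {ξ : EuclideanSpace ℝ (Fin K)} (hξ : ξ ∈ D.support) :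
    ∃ b : Fin M ⊕ Fin J → ℝ, 0 ≤ b ∧ D.residual ξ.ofLp b = -D.extq := by
  obtain ⟨p, hp, hQ⟩ := h ξ hξ
  refine ⟨Sum.elim p (D.t - D.S *ᵥ ξ.ofLp), ?_,
    (D.residual_sumElim_eq_neg_extq_iff _ _ _).mpr ⟨hQ, rfl⟩⟩
  rintro (j | j)
  · exact hp j
  · exact sub_nonneg.mpr (hξ.2 j)

/-- Strong duality of the recourse problem. -/
theorem recourse_le_of_forall_dualForm_le (x : Fin N₁ → ℝ) {ξ : EuclideanSpace ℝ (Fin K)}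
    (hrec : D.SufficientlyExpensiveRecourse) (hξ : ξ ∈ D.support) (r : ℝ)
    (hr : ∀ b, 0 ≤ b → D.residual ξ.ofLp b = -D.extq → D.dualForm x 0 ξ.ofLp b 1 ≤ r) :
    D.recourse x ξ ≤ r := by
  obtain ⟨p₀, hp₀, hQ⟩ := hrec ξ hξ
  obtain ⟨y, hy, hle⟩ := exists_primal_le_of_forall_dual_le D.W (D.T x *ᵥ ξ.ofLp + D.h x)
    (D.Q *ᵥ ξ.ofLp + D.q) r p₀ hp₀ hQ (fun p hp hpQ => by
      rw [← D.dualForm_zero_sumElim x ξ.ofLp p (D.t - D.S *ᵥ ξ.ofLp)]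
      refine hr _ ?_ ((D.residual_sumElim_eq_neg_extq_iff _ _ _).mpr ⟨hpQ, rfl⟩)
      rintro (j | j)
      · exact hp j
      · exact sub_nonneg.mpr (hξ.2 j))
  exact (iInf₂_le y hy).trans (EReal.coe_le_coe_iff.mpr hle)

theorem measurableSet_support : MeasurableSet D.support := by
  have h1 : IsClosed {ξ : EuclideanSpace ℝ (Fin K) | 0 ≤ ξ.ofLp} :=
    isClosed_le continuous_const (PiLp.continuous_ofLp 2 _)
  have h2 : IsClosed {ξ : EuclideanSpace ℝ (Fin K) | D.S *ᵥ ξ.ofLp ≤ D.t} :=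
    isClosed_le (Continuous.matrix_mulVec continuous_const (PiLp.continuous_ofLp 2 _))
      continuous_const
  exact (h1.inter h2).measurableSet

theorem empirical_eq (D : TwoStageDRLP N₁ N₂ K M J I) :
    D.empirical = ∑ i, ENNReal.ofReal (1 / (I : ℝ)) • Measure.dirac (D.sample i) := by
  rcases Nat.eq_zero_or_pos I with rfl | hI
  · simp [empirical]
  · rw [empirical, one_div, ENNReal.ofReal_inv_of_pos (by exact_mod_cast hI), ENNReal.ofReal_natCast,
      Finset.smul_sum]

/-- Finitely supported measures in the ambiguity set. -/
theorem sum_dirac_mem_ambiguitySet (hI : 0 < I) (hradius : 0 ≤ D.radius) {k : Fin I → ℕ}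
    (w : ∀ i, Fin (k i) → ℝ) (ξ : ∀ i, Fin (k i) → EuclideanSpace ℝ (Fin K))
    (hw : ∀ i l, 0 ≤ w i l) (hw1 : ∀ i, ∑ l, w i l = 1 / (I : ℝ))
    (hξ : ∀ i l, ξ i l ∈ D.support)
    (hcost : ∑ i, ∑ l, w i l * ‖ξ i l - D.sample i‖ ^ 2 ≤ D.radius ^ 2)
    (hsample : ∀ i, D.sample i ∈ D.support) :
    ∑ s : Σ i, Fin (k i), ENNReal.ofReal (w s.1 s.2) • Measure.dirac (ξ s.1 s.2) ∈
      D.ambiguitySet := by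
  have hI' : (0 : ℝ) < I := by exact_mod_cast hI
  refine ⟨⟨⟨?_⟩, ?_, D.sample ⟨0, hI⟩, hsample _, ?_⟩, ?_⟩
  · simp only [Measure.coe_finsetSum, Finset.sum_apply, Measure.smul_apply, measure_univ,
      smul_eq_mul, mul_one]
    rw [← ENNReal.ofReal_sum_of_nonneg fun s _ => hw _ _, Fintype.sum_sigma]
    simp [hw1, hI'.ne']
  · simp only [Measure.coe_finsetSum, Finset.sum_apply, Measure.smul_apply, smul_eq_mul]
    refine Finset.sum_eq_zero fun s _ => ?_
    rw [Measure.dirac_apply' _ D.measurableSet_support.compl]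
    simp [hξ]
  · rw [lintegral_sum_ofReal_smul_dirac]
    refine ENNReal.sum_lt_top.mpr fun s _ => ENNReal.mul_lt_top ENNReal.ofReal_lt_top ?_
    exact ENNReal.pow_lt_top enorm_lt_top
  · let ρ : Measure (EuclideanSpace ℝ (Fin K) × EuclideanSpace ℝ (Fin K)) :=
      ∑ s : Σ i, Fin (k i), ENNReal.ofReal (w s.1 s.2) •
        Measure.dirac (ξ s.1 s.2, D.sample s.1)
    have hfst : ρ.map Prod.fst =
        ∑ s : Σ i, Fin (k i), ENNReal.ofReal (w s.1 s.2) • Measure.dirac (ξ s.1 s.2) := by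
      rw [Measure.map_finset_sum' measurable_fst.aemeasurable]
      refine Finset.sum_congr rfl fun s _ => ?_
      rw [Measure.map_smul, Measure.map_dirac' measurable_fst]
    have hsnd : ρ.map Prod.snd = D.empirical := by
      rw [Measure.map_finset_sum' measurable_snd.aemeasurable, empirical_eq, Fintype.sum_sigma]
      refine Finset.sum_congr rfl fun i _ => ?_
      simp only [Measure.map_smul, Measure.map_dirac' measurable_snd]
      rw [← Finset.sum_smul, ← ENNReal.ofReal_sum_of_nonneg fun l _ => hw i l, hw1]
    refine (iInf₂_le ρ ⟨hfst, hsnd⟩).trans ?_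
    rw [lintegral_sum_ofReal_smul_dirac]
    have e : ∀ s : Σ i, Fin (k i), ENNReal.ofReal (w s.1 s.2) *
        ‖(ξ s.1 s.2, D.sample s.1).1 - (ξ s.1 s.2, D.sample s.1).2‖ₑ ^ 2 =
        ENNReal.ofReal (w s.1 s.2 * ‖ξ s.1 s.2 - D.sample s.1‖ ^ 2) := fun s => by
      rw [ENNReal.ofReal_mul (hw _ _), ENNReal.ofReal_pow (norm_nonneg _), ofReal_norm]
    simp only [e]
    rw [← ENNReal.ofReal_sum_of_nonneg fun s _ => mul_nonneg (hw _ _) (sq_nonneg _),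
      Fintype.sum_sigma]
    calc ENNReal.ofReal (∑ i, ∑ l, w i l * ‖ξ i l - D.sample i‖ ^ 2) ^ (1 / 2 : ℝ)
        ≤ ENNReal.ofReal (D.radius ^ 2) ^ (1 / 2 : ℝ) := by gcongr
      _ = ENNReal.ofReal D.radius := by
        rw [ENNReal.ofReal_rpow_of_nonneg (sq_nonneg _) (by norm_num), ← Real.sqrt_eq_rpow,
          Real.sqrt_sq hradius]

/-- Atoms with positive last component that satisfy the homogenized dual constraints bound the
worst-case expectation from below. -/
theorem sum_dualForm_le_worstCase (hI : 0 < I) (hradius : 0 ≤ D.radius)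
    (hsample : ∀ i, D.sample i ∈ D.support) (x : Fin N₁ → ℝ) {k : Fin I → ℕ}
    (a : ∀ i, Fin (k i) → Fin K → ℝ) (b : ∀ i, Fin (k i) → Fin M ⊕ Fin J → ℝ)
    (c : ∀ i, Fin (k i) → ℝ) (ha : ∀ i l, 0 ≤ a i l) (hb : ∀ i l, 0 ≤ b i l)
    (hc : ∀ i l, 0 < c i l) (hN : ∀ i, 1 ≤ ∑ l, c i l ^ 2)
    (hres : ∀ i l, D.residual (a i l) (b i l) = -(c i l • D.extq))
    (hcost : (1 / (I : ℝ)) * ∑ i, ∑ l, (a i l ⬝ᵥ a i l -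
      2 * c i l * ((D.sample i).ofLp ⬝ᵥ a i l) +
      c i l ^ 2 * ((D.sample i).ofLp ⬝ᵥ (D.sample i).ofLp)) ≤ D.radius ^ 2) :
    (((1 / (I : ℝ)) * ∑ i, (∑ l, c i l ^ 2)⁻¹ * ∑ l, D.dualForm x 0 (a i l) (b i l) (c i l) : ℝ) :
      EReal) ≤ D.worstCase x := by
  have hI' : (0 : ℝ) < I := by exact_mod_cast hI
  have hN0 : ∀ i, 0 < ∑ l, c i l ^ 2 := fun i => zero_lt_one.trans_le (hN i)
  let w : ∀ i, Fin (k i) → ℝ := fun i l => 1 / (I : ℝ) * ((∑ l, c i l ^ 2)⁻¹ * c i l ^ 2)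
  have hw : ∀ i l, 0 ≤ w i l := fun i l => by
    have := (hN0 i).le
    positivity
  let ξ : ∀ i, Fin (k i) → EuclideanSpace ℝ (Fin K) := fun i l =>
    WithLp.toLp 2 ((c i l)⁻¹ • a i l)
  let β : ∀ i, Fin (k i) → Fin M ⊕ Fin J → ℝ := fun i l => (c i l)⁻¹ • b i l
  have hξ0 : ∀ i l, 0 ≤ (ξ i l).ofLp := fun i l => smul_nonneg (inv_nonneg.mpr (hc i l).le) (ha i l)
  have hβ0 : ∀ i l, 0 ≤ β i l := fun i l => smul_nonneg (inv_nonneg.mpr (hc i l).le) (hb i l)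
  have hξβ : ∀ i l, D.residual (ξ i l).ofLp (β i l) = -D.extq := fun i l => by
    change D.residual ((c i l)⁻¹ • a i l) ((c i l)⁻¹ • b i l) = _
    rw [residual_smul, hres, smul_neg, smul_smul, inv_mul_cancel₀ (hc i l).ne', one_smul]
  have hmem := D.sum_dirac_mem_ambiguitySet hI hradius w ξ hw
    (fun i => by
      simp only [w, ← Finset.mul_sum]
      rw [inv_mul_cancel₀ (hN0 i).ne', mul_one])
    (fun i l => D.mem_support_of_residual_eq _ (hξ0 i l) (hβ0 i l) (hξβ i l))
    (by
      refine le_trans ?_ hcost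
      simp only [Finset.mul_sum]
      refine Finset.sum_le_sum fun i _ => Finset.sum_le_sum fun l _ => ?_
      have e : ‖ξ i l - D.sample i‖ ^ 2 * c i l ^ 2 = a i l ⬝ᵥ a i l -
          2 * c i l * ((D.sample i).ofLp ⬝ᵥ a i l) +
          c i l ^ 2 * ((D.sample i).ofLp ⬝ᵥ (D.sample i).ofLp) := by
        rw [EuclideanSpace.real_norm_sq_eq]
        simp only [dotProduct, Finset.mul_sum, Finset.sum_mul, ← Finset.sum_sub_distrib,
          ← Finset.sum_add_distrib]
        refine Finset.sum_congr rfl fun j _ => ?_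
        have hcj := (hc i l).ne'
        simp only [PiLp.sub_apply, ξ, Pi.smul_apply, smul_eq_mul]
        field_simp
        ring
      rw [← e]
      -- Since the total is at least one, normalizing the weights can only lower the transport cost.
      have h1 : (∑ l, c i l ^ 2)⁻¹ ≤ 1 := inv_le_one_of_one_le₀ (hN i)
      calc w i l * ‖ξ i l - D.sample i‖ ^ 2
          = 1 / (I : ℝ) * ((∑ l, c i l ^ 2)⁻¹ * (‖ξ i l - D.sample i‖ ^ 2 * c i l ^ 2)) := by
            simp only [w]
            ring
        _ ≤ 1 / (I : ℝ) * (1 * (‖ξ i l - D.sample i‖ ^ 2 * c i l ^ 2)) := by gcongr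
        _ = _ := by rw [one_mul])
    hsample
  refine le_trans ?_ (le_iSup₂ (f := fun P _ => extExpectation P (D.recourse x)) _ hmem)
  refine le_trans (le_of_eq ?_) (le_extExpectation_sum_dirac
    (fun s : Σ i, Fin (k i) => hw s.1 s.2) (fun s => ξ s.1 s.2)
    (r := fun s => D.dualForm x 0 (ξ s.1 s.2).ofLp (β s.1 s.2) 1)
    fun s => D.dualForm_le_recourse x _ (hβ0 _ _) (hξβ _ _))
  rw [Fintype.sum_sigma, Finset.mul_sum]
  congr 1
  refine Finset.sum_congr rfl fun i _ => ?_
  rw [Finset.mul_sum, Finset.mul_sum]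
  refine Finset.sum_congr rfl fun l _ => ?_
  have e : D.dualForm x 0 (ξ i l).ofLp (β i l) 1 =
      (c i l)⁻¹ ^ 2 * D.dualForm x 0 (a i l) (b i l) (c i l) := by
    rw [← dualForm_smul, smul_eq_mul, inv_mul_cancel₀ (hc i l).ne']
  have hcj := (hc i l).ne'
  have hNi := (hN0 i).ne'
  simp only [e, w]
  field_simp

/-- The objective value of every feasible point of the completely positive program is a lower
bound of the worst-case expectation. -/
theorem completelyPositiveObjective_le_worstCase (hI : 0 < I) (hradius : 0 ≤ D.radius)
    (hsample : ∀ i, D.sample i ∈ D.support) (hrec : D.SufficientlyExpensiveRecourse)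
    (x : Fin N₁ → ℝ) {v : CompletelyPositiveVars K M J I} (hv : D.CompletelyPositiveFeasible v) :
    ((D.completelyPositiveObjective x 0 v : ℝ) : EReal) ≤ D.worstCase x := by
  choose k a b c ha hb hc hs hres hΩ hY hμ hΓ hγ using hv.exists_atoms
  choose b₀ hb₀ hres₀ using fun i => hrec.exists_residual_eq (hsample i)
  -- An atom with `c = 0` has no location `a / c`, so all atoms are shifted by `κ` times the
  -- dual-feasible atom of the sample, whose last component is one. The shift keeps the homogenized
  -- constraints and leaves `a - c ξ̂ᵢ` unchanged, hence also the unnormalized transport cost. Then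
  -- `κ` tends to zero.
  let F : ℝ → ℝ := fun κ => (1 / (I : ℝ)) * ∑ i, (∑ l, (c i l + κ) ^ 2)⁻¹ *
    ∑ l, D.dualForm x 0 (a i l + κ • (D.sample i).ofLp) (b i l + κ • b₀ i) (c i l + κ)
  have hF : ContinuousAt F 0 := by
    have h1 : ∀ i, ContinuousAt (fun κ : ℝ => (∑ l, (c i l + κ) ^ 2)⁻¹) 0 := fun i => by
      refine ContinuousAt.inv₀ (by fun_prop) ?_
      simp [hs]
    have h2 : ∀ i l, Continuous fun κ : ℝ => D.dualForm x 0 (a i l + κ • (D.sample i).ofLp)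
        (b i l + κ • b₀ i) (c i l + κ) := fun i l => by
      simp only [dualForm, dotProduct, mulVec, Pi.add_apply, Pi.smul_apply]
      fun_prop
    refine continuousAt_const.mul (tendsto_finsetSum _ fun i _ => ?_)
    exact (h1 i).mul (continuous_finsetSum _ fun l _ => h2 i l).continuousAt
  have hF0 : F 0 = D.completelyPositiveObjective x 0 v := by
    simp only [F, add_zero, zero_smul, hs, inv_one, one_mul, sum_dualForm,
      completelyPositiveObjective, ← hY, ← hγ, ← hΓ]
  have hle : ∀ κ : ℝ, 0 < κ → ((F κ : ℝ) : EReal) ≤ D.worstCase x := fun κ hκ => by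
    refine D.sum_dualForm_le_worstCase hI hradius hsample x _ _ _ (fun i l => ?_) (fun i l => ?_)
      (fun i l => ?_) (fun i => ?_) (fun i l => ?_) ?_
    · exact add_nonneg (ha i l) (smul_nonneg hκ.le (hsample i).1)
    · exact add_nonneg (hb i l) (smul_nonneg hκ.le (hb₀ i))
    · exact add_pos_of_nonneg_of_pos (hc i l) hκ
    · rw [← hs i]
      refine Finset.sum_le_sum fun l _ => ?_
      have := hc i l
      gcongr
      linarith
    · rw [residual_add, residual_smul, hres, hres₀, add_smul, smul_neg, neg_add]
    · refine le_trans (le_of_eq ?_) hv.radius_bound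
      congr 1
      refine Finset.sum_congr rfl fun i _ => ?_
      rw [hΩ, hμ]
      simp only [trace_sum, trace_vecMulVec, dotProduct_sum, dotProduct_smul, smul_eq_mul,
        Finset.mul_sum]
      have e : (D.sample i).ofLp ⬝ᵥ (D.sample i).ofLp =
          ∑ l, c i l ^ 2 * ((D.sample i).ofLp ⬝ᵥ (D.sample i).ofLp) := by
        rw [← Finset.sum_mul, hs, one_mul]
      conv_rhs => rw [e]
      rw [← Finset.sum_sub_distrib, ← Finset.sum_add_distrib]
      refine Finset.sum_congr rfl fun l _ => ?_
      simp only [add_dotProduct, dotProduct_add, smul_dotProduct, dotProduct_smul, smul_eq_mul,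
        dotProduct_comm (a i l) (D.sample i).ofLp]
      ring
  have hlim : Tendsto (fun κ => ((F κ : ℝ) : EReal)) (𝓝[>] 0)
      (𝓝 ((D.completelyPositiveObjective x 0 v : ℝ) : EReal)) := by
    rw [← hF0]
    exact (continuous_coe_real_ereal.continuousAt.comp hF).tendsto.mono_left nhdsWithin_le_nhds
  exact le_of_tendsto hlim (eventually_nhdsWithin_of_forall hle)

/-- The samples yield a feasible point of the completely positive program. -/
theorem exists_completelyPositiveFeasible (hsample : ∀ i, D.sample i ∈ D.support)
    (hrec : D.SufficientlyExpensiveRecourse) : ∃ v, D.CompletelyPositiveFeasible v := by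
  choose b₀ hb₀ hres₀ using fun i => hrec.exists_residual_eq (hsample i)
  refine ⟨{ γ := fun i => ∑ _l : Unit, (1 : ℝ) • b₀ i
            μ := fun i => ∑ _l : Unit, (1 : ℝ) • (D.sample i).ofLp
            Γ := fun i => ∑ _l : Unit, vecMulVec (b₀ i) (b₀ i)
            Ω := fun i => ∑ _l : Unit, vecMulVec (D.sample i).ofLp (D.sample i).ofLp
            Y := fun i => ∑ _l : Unit, vecMulVec (D.sample i).ofLp (b₀ i) },
    fun i => ?_, fun i => ?_, fun i => posSemidef_sum_vecMulVec_self fun _ : Unit => b₀ i,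
    fun i => posSemidef_sum_vecMulVec_self fun _ : Unit => (D.sample i).ofLp,
    fun i => ?_, fun i j => ?_, ?_, fun i => ?_⟩
  · simpa using hb₀ i
  · simpa using (hsample i).1
  · have := hres₀ i
    rw [residual, sub_eq_iff_eq_add] at this
    simp [this]
  · rw [← sum_residual_sq D (fun _ => (D.sample i).ofLp) (fun _ => b₀ i) j]
    simp [hres₀]
  · refine le_trans (le_of_eq ?_) (sq_nonneg D.radius)
    simp only [Finset.univ_unique, Finset.sum_singleton, trace_vecMulVec, one_smul]
    rw [Finset.sum_eq_zero fun i _ => by ring, mul_zero]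
  · have := isCompletelyPositive_of_atoms (fun _ : Unit => (D.sample i).ofLp) (fun _ => b₀ i)
      (fun _ => 1) (fun _ => (hsample i).1) (fun _ => hb₀ i) (fun _ => zero_le_one)
    simpa using this

end TwoStageDRLP

/-! ### Measurability, transport, and the upper bound of the worst case -/

/-- A strict superlevel set is a countable union of projections of closed sets. These are σ-compact,
so their projections are countable unions of compact sets and no analytic sets arise. -/
theorem measurable_iSup_ofReal_of_isClosed {X Y : Type*} [TopologicalSpace X] [TopologicalSpace Y]
    [MeasurableSpace X] [BorelSpace X] [T2Space X] [SigmaCompactSpace (X × Y)] {s : Set (X × Y)}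
    (hs : IsClosed s) {f : X × Y → ℝ} (hf : Continuous f) :
    Measurable fun x => ⨆ (y : Y) (_ : (x, y) ∈ s), ENNReal.ofReal (f (x, y)) := by
  refine measurable_of_Ioi fun t => ?_
  rcases eq_or_ne t ⊤ with rfl | ht
  · simp
  have e : (fun x => ⨆ (y : Y) (_ : (x, y) ∈ s), ENNReal.ofReal (f (x, y))) ⁻¹' Set.Ioi t =
      ⋃ n : ℕ, Prod.fst '' (s ∩ {z | t.toReal + 1 / ((n : ℝ) + 1) ≤ f z}) := by
    ext x
    simp only [Set.mem_preimage, Set.mem_Ioi, lt_iSup_iff, Set.mem_iUnion, Set.mem_image,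
      Set.mem_inter_iff, Set.mem_ofPred_eq]
    constructor
    · rintro ⟨y, hy, hlt⟩
      rw [ENNReal.lt_ofReal_iff_toReal_lt ht] at hlt
      obtain ⟨n, hn⟩ := exists_nat_one_div_lt (sub_pos.mpr hlt)
      exact ⟨n, (x, y), ⟨hy, by linarith⟩, rfl⟩
    · rintro ⟨n, ⟨x', y⟩, ⟨hy, hle⟩, rfl⟩
      refine ⟨y, hy, (ENNReal.lt_ofReal_iff_toReal_lt ht).mpr (lt_of_lt_of_le ?_ hle)⟩
      have : (0 : ℝ) < 1 / ((n : ℝ) + 1) := by positivity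
      linarith
  rw [e]
  refine MeasurableSet.iUnion fun n => ?_
  obtain ⟨k, hk, hku⟩ := (isSigmaCompact_univ.of_isClosed_subset
    (hs.inter (isClosed_le continuous_const hf)) (Set.subset_univ _)).image
      (continuous_fst (X := X) (Y := Y))
  rw [← hku]
  exact MeasurableSet.iUnion fun m => (hk m).measurableSet

namespace TwoStageDRLP

variable {N₁ N₂ K M J I : ℕ} (D : TwoStageDRLP N₁ N₂ K M J I)

/-- Transport bound: a function that is dominated by quadratic functions centered at the samples
has a small integral under every measure in the ambiguity set. -/
theorem lintegral_le_of_mem_ambiguitySet (hradius : 0 ≤ D.radius)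
    {P : Measure (EuclideanSpace ℝ (Fin K))} (hP : P ∈ D.ambiguitySet)
    (F : EuclideanSpace ℝ (Fin K) → ℝ≥0∞) (c : Fin I → ℝ) (hc : ∀ i, 0 ≤ c i) (lam : ℝ)
    (hlam : 0 ≤ lam) (hF : ∀ ξ ∈ D.support, ∀ i,
      F ξ ≤ ENNReal.ofReal (c i + lam * ‖ξ - D.sample i‖ ^ 2)) :
    ∫⁻ ξ, F ξ ∂P ≤ ENNReal.ofReal (1 / (I : ℝ) * ∑ i, c i + lam * D.radius ^ 2) := by
  classical
  have hsum : 0 ≤ 1 / (I : ℝ) * ∑ i, c i :=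
    mul_nonneg (by positivity) (Finset.sum_nonneg fun i _ => hc i)
  have hcoupling : ∀ ρ : Measure (EuclideanSpace ℝ (Fin K) × EuclideanSpace ℝ (Fin K)),
      ρ.map Prod.fst = P → ρ.map Prod.snd = D.empirical →
      ∫⁻ ξ, F ξ ∂P ≤ ENNReal.ofReal (1 / (I : ℝ) * ∑ i, c i) +
        ENNReal.ofReal lam * ∫⁻ z, ‖z.1 - z.2‖ₑ ^ 2 ∂ρ := by
    intro ρ h1 h2
    -- The constants `c i` depend on the index, not on the point, and samples may coincide; the
    -- infimum takes the smallest constant at each sample. The value off the samples is `⊤`, which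
    -- the empirical measure does not see.
    let g : EuclideanSpace ℝ (Fin K) → ℝ≥0∞ := fun ξ =>
      ⨅ i, if ξ = D.sample i then ENNReal.ofReal (c i) else ⊤
    have hg : Measurable g := Measurable.iInf fun i =>
      Measurable.ite (measurableSet_singleton _) measurable_const measurable_const
    have hae : ∀ᵐ z ∂ρ, z.1 ∈ D.support := by
      have h0 : P D.supportᶜ = 0 := hP.1.2.1
      rw [← h1, Measure.map_apply measurable_fst D.measurableSet_support.compl] at h0
      exact h0
    have hbound : ∀ᵐ z ∂ρ, F z.1 ≤ g z.2 + ENNReal.ofReal lam * ‖z.1 - z.2‖ₑ ^ 2 := by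
      filter_upwards [hae] with z hz
      rw [← tsub_le_iff_right]
      refine le_iInf fun i => ?_
      split_ifs with h
      · rw [tsub_le_iff_right, h, ← ofReal_norm, ← ENNReal.ofReal_pow (norm_nonneg _),
          ← ENNReal.ofReal_mul hlam, ← ENNReal.ofReal_add (hc i) (by positivity)]
        exact hF _ hz i
      · exact le_top
    calc ∫⁻ ξ, F ξ ∂P ≤ ∫⁻ z, F z.1 ∂ρ := by
          rw [← h1]
          exact lintegral_map_le _ _
      _ ≤ ∫⁻ z, (g z.2 + ENNReal.ofReal lam * ‖z.1 - z.2‖ₑ ^ 2) ∂ρ := lintegral_mono_ae hbound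
      _ = ∫⁻ ξ, g ξ ∂D.empirical + ENNReal.ofReal lam * ∫⁻ z, ‖z.1 - z.2‖ₑ ^ 2 ∂ρ := by
          rw [lintegral_add_left (f := fun z : _ × EuclideanSpace ℝ (Fin K) => g z.2)
              (hg.comp measurable_snd),
            lintegral_const_mul' _ _ ENNReal.ofReal_ne_top, ← h2, lintegral_map hg measurable_snd]
      _ ≤ _ := by
          gcongr
          rw [empirical_eq, lintegral_sum_ofReal_smul_dirac, Finset.mul_sum,
            ENNReal.ofReal_sum_of_nonneg fun i _ => mul_nonneg (by positivity) (hc i)]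
          refine Finset.sum_le_sum fun i _ => ?_
          rw [ENNReal.ofReal_mul (by positivity)]
          gcongr
          exact (iInf_le _ i).trans (by simp)
  -- The margin `η` avoids the existence of an optimal coupling.
  have hη : ∀ η : ℝ, 0 < η → ∫⁻ ξ, F ξ ∂P ≤
      ENNReal.ofReal (1 / (I : ℝ) * ∑ i, c i + lam * (D.radius + η) ^ 2) := by
    intro η hη
    have hlt : wasserstein2 P D.empirical < ENNReal.ofReal (D.radius + η) :=
      hP.2.trans_lt ((ENNReal.ofReal_lt_ofReal_iff (by linarith)).mpr (by linarith))
    simp only [wasserstein2, iInf_lt_iff] at hlt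
    obtain ⟨ρ, ⟨h1, h2⟩, hρ⟩ := hlt
    have hA : ∫⁻ z, ‖z.1 - z.2‖ₑ ^ 2 ∂ρ ≤ ENNReal.ofReal ((D.radius + η) ^ 2) := by
      have := ENNReal.rpow_le_rpow hρ.le (z := 2) (by norm_num)
      rw [← ENNReal.rpow_mul] at this
      norm_num at this
      rwa [ENNReal.ofReal_pow (by linarith)]
    refine (hcoupling ρ h1 h2).trans ?_
    rw [ENNReal.ofReal_add hsum (by positivity), ENNReal.ofReal_mul hlam]
    gcongr
  have hlim : Tendsto (fun η : ℝ => ENNReal.ofReal (1 / (I : ℝ) * ∑ i, c i +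
      lam * (D.radius + η) ^ 2)) (𝓝[>] 0)
      (𝓝 (ENNReal.ofReal (1 / (I : ℝ) * ∑ i, c i + lam * (D.radius + 0) ^ 2))) := by
    refine Tendsto.mono_left (Continuous.tendsto ?_ 0) nhdsWithin_le_nhds
    exact ENNReal.continuous_ofReal.comp (by fun_prop)
  rw [add_zero] at hlim
  exact ge_of_tendsto hlim (eventually_nhdsWithin_of_forall hη)

/-- The truncated regularized recourse function. -/
noncomputable def regularizedRecourse (x : Fin N₁ → ℝ) (δ C : ℝ)
    (ξ : EuclideanSpace ℝ (Fin K)) : ℝ≥0∞ :=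
  ⨆ (b : Fin M ⊕ Fin J → ℝ)
    (_ : (ξ, b) ∈ {z : EuclideanSpace ℝ (Fin K) × (Fin M ⊕ Fin J → ℝ) |
      0 ≤ z.2 ∧ D.residual z.1.ofLp z.2 = -D.extq}),
    ENNReal.ofReal (D.dualForm x δ ξ.ofLp b 1 + C)

theorem measurable_regularizedRecourse (x : Fin N₁ → ℝ) (δ C : ℝ) :
    Measurable (D.regularizedRecourse x δ C) := by
  refine measurable_iSup_ofReal_of_isClosed
    (f := fun z : EuclideanSpace ℝ (Fin K) × (Fin M ⊕ Fin J → ℝ) =>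
      D.dualForm x δ z.1.ofLp z.2 1 + C) ?_ ?_
  · have h : Continuous fun z : EuclideanSpace ℝ (Fin K) × (Fin M ⊕ Fin J → ℝ) =>
        D.residual z.1.ofLp z.2 := by
      refine continuous_pi fun j => ?_
      simp only [residual, mulVec, dotProduct, Pi.sub_apply]
      fun_prop
    exact (isClosed_le continuous_const continuous_snd).inter (isClosed_eq h continuous_const)
  · simp only [dualForm, mulVec, dotProduct]
    fun_prop

theorem dualForm_anti (x : Fin N₁ → ℝ) {δ δ' : ℝ} (h : δ ≤ δ') (a : Fin K → ℝ)
    (b : Fin M ⊕ Fin J → ℝ) (c : ℝ) : D.dualForm x δ' a b c ≤ D.dualForm x δ a b c := by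
  have : 0 ≤ b ⬝ᵥ b := Finset.sum_nonneg fun j _ => mul_self_nonneg (b j)
  unfold dualForm
  gcongr

/-- With the residual fixed, the `ψ` and `φ` terms are constant and only the transport cost still
depends on `ξ`. The constant is the `i`-th summand of the copositive objective. -/
theorem linearForm_of_residual_eq (i : Fin I) (v : CopositiveVars N₂ J I)
    (ξ : EuclideanSpace ℝ (Fin K)) {b : Fin M ⊕ Fin J → ℝ}
    (h : D.residual ξ.ofLp b = -D.extq) :
    D.linearForm i v ξ.ofLp b 1 = v.s i + D.extq ⬝ᵥ v.ψ i - v.lam * ‖D.sample i‖ ^ 2 +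
      ∑ j, v.φ i j * D.extq j ^ 2 + v.lam * ‖ξ - D.sample i‖ ^ 2 := by
  have e : ‖ξ - D.sample i‖ ^ 2 = ξ.ofLp ⬝ᵥ ξ.ofLp - 2 * ((D.sample i).ofLp ⬝ᵥ ξ.ofLp) +
      (D.sample i).ofLp ⬝ᵥ (D.sample i).ofLp := by
    rw [EuclideanSpace.real_norm_sq_eq]
    simp only [dotProduct, Finset.mul_sum, ← Finset.sum_sub_distrib, ← Finset.sum_add_distrib]
    refine Finset.sum_congr rfl fun j _ => ?_
    rw [PiLp.sub_apply]
    ring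
  rw [linearForm, h, e, norm_sample_sq, dotProduct_neg, dotProduct_comm D.extq]
  simp only [Pi.neg_apply, neg_sq]
  ring

/-- The recourse function enters as `f`, without any measurability. The bound `f ≤ G - C` is
rewritten as `f⁺ + C ≤ G + f⁻`, where each side has a measurable summand and the integrals therefore
split. -/
theorem extExpectation_le_of_add_le {α : Type*} [MeasurableSpace α] {P : Measure α}
    [IsProbabilityMeasure P] {f : α → EReal} {G : α → ℝ≥0∞} (hG : Measurable G) {C L : ℝ}
    (hC : 0 ≤ C) (hLC : 0 ≤ L + C)
    (hle : ∀ᵐ a ∂P, G a ≠ ⊤ → f a ≤ (((G a).toReal - C : ℝ) : EReal))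
    (hint : ∫⁻ a, G a ∂P ≤ ENNReal.ofReal (L + C)) : extExpectation P f ≤ L := by
  have hpoint : ∀ᵐ a ∂P, (f a).toENNReal + ENNReal.ofReal C ≤ G a + (-f a).toENNReal := by
    filter_upwards [hle] with a ha
    rcases eq_or_ne (G a) ⊤ with h | h
    · simp [h]
    have hb := ha h
    induction hf : f a with
    | bot => simp
    | top =>
      rw [hf] at hb
      exact absurd (top_le_iff.mp hb) (EReal.coe_ne_top _)
    | coe r =>
      rw [hf, EReal.coe_le_coe_iff] at hb
      rw [← EReal.coe_neg, EReal.real_coe_toENNReal, EReal.real_coe_toENNReal,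
        ← ENNReal.ofReal_toReal h]
      rcases le_total 0 r with h0 | h0
      · rw [ENNReal.ofReal_of_nonpos (neg_nonpos.mpr h0), add_zero, ← ENNReal.ofReal_add h0 hC]
        exact ENNReal.ofReal_le_ofReal (by linarith)
      · rw [ENNReal.ofReal_of_nonpos h0, zero_add,
          ← ENNReal.ofReal_add ENNReal.toReal_nonneg (by linarith)]
        exact ENNReal.ofReal_le_ofReal (by linarith)
  have h := lintegral_mono_ae hpoint
  rw [lintegral_add_right _ measurable_const, lintegral_add_left hG, lintegral_const,
    measure_univ, mul_one] at h
  replace h := h.trans (add_le_add_left hint _)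
  rw [extExpectation]
  set A := ∫⁻ a, (f a).toENNReal ∂P
  set B := ∫⁻ a, (-f a).toENNReal ∂P
  rcases eq_or_ne B ⊤ with hB | hB
  · simp [hB]
  have hA : A ≠ ⊤ := by
    have : A + ENNReal.ofReal C ≠ ⊤ :=
      ne_top_of_le_ne_top (ENNReal.add_ne_top.mpr ⟨ENNReal.ofReal_ne_top, hB⟩) h
    exact (ENNReal.add_ne_top.mp this).1
  rw [← ENNReal.ofReal_toReal hA, ← ENNReal.ofReal_toReal hB,
    ← ENNReal.ofReal_add ENNReal.toReal_nonneg hC, ← ENNReal.ofReal_add hLC ENNReal.toReal_nonneg,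
    ENNReal.ofReal_le_ofReal_iff (add_nonneg hLC ENNReal.toReal_nonneg)] at h
  rw [← EReal.coe_ennreal_toReal hA, ← EReal.coe_ennreal_toReal hB, ← EReal.coe_sub,
    EReal.coe_le_coe_iff]
  linarith

/-- Bounds of the perturbed copositive programs bound the worst-case expectation. -/
theorem worstCase_le_of_copositiveValue_le (hI : 0 < I) (hradius : 0 ≤ D.radius)
    (hsample : ∀ i, D.sample i ∈ D.support) (hrec : D.SufficientlyExpensiveRecourse)
    (x : Fin N₁ → ℝ) (L : ℝ) (hL : ∀ δ : ℝ, 0 < δ → D.copositiveValue δ x ≤ L) :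
    D.worstCase x ≤ L := by
  have hI' : (0 : ℝ) < I := by exact_mod_cast hI
  choose b₀ hb₀ hres₀ using fun i => hrec.exists_residual_eq (hsample i)
  -- One constant for all `δ ≤ 1`: as `dualForm` is antitone in `δ`, its value at `δ = 1` bounds it
  -- from below at the samples. This makes the constants of the transport bound nonnegative, and
  -- `|L|` makes `L + C` nonnegative.
  let C : ℝ := ∑ i, |D.dualForm x 1 (D.sample i).ofLp (b₀ i) 1| + |L|
  have hCi : ∀ i, -C ≤ D.dualForm x 1 (D.sample i).ofLp (b₀ i) 1 := fun i => by
    have h1 := Finset.single_le_sum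
      (f := fun i => |D.dualForm x 1 (D.sample i).ofLp (b₀ i) 1|)
      (fun i _ => abs_nonneg _) (Finset.mem_univ i)
    have h2 := neg_abs_le (D.dualForm x 1 (D.sample i).ofLp (b₀ i) 1)
    have h3 := abs_nonneg L
    simp only [C]
    linarith
  have hC0 : 0 ≤ ∑ i, |D.dualForm x 1 (D.sample i).ofLp (b₀ i) 1| :=
    Finset.sum_nonneg fun i _ => abs_nonneg _
  have hC : 0 ≤ C := add_nonneg hC0 (abs_nonneg L)
  have hLC : 0 ≤ L + C := by
    have := neg_abs_le L
    simp only [C]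
    linarith
  refine iSup₂_le fun P hP => ?_
  have hprob : IsProbabilityMeasure P := hP.1.1
  have hint : ∀ δ : ℝ, 0 < δ → δ ≤ 1 →
      ∫⁻ ξ, D.regularizedRecourse x δ C ξ ∂P ≤ ENNReal.ofReal (L + C) := by
    intro δ hδ hδ1
    have hη : ∀ η : ℝ, 0 < η →
        ∫⁻ ξ, D.regularizedRecourse x δ C ξ ∂P ≤ ENNReal.ofReal (L + η + C) := by
      intro η hη
      have hlt : D.copositiveValue δ x < ((L + η : ℝ) : EReal) :=
        (hL δ hδ).trans_lt (EReal.coe_lt_coe_iff.mpr (by linarith))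
      simp only [copositiveValue, iInf_lt_iff] at hlt
      obtain ⟨v, ⟨hlam, hv⟩, hobj⟩ := hlt
      rw [EReal.coe_lt_coe_iff] at hobj
      have key : ∀ i (ξ : EuclideanSpace ℝ (Fin K)) b, 0 ≤ ξ.ofLp → 0 ≤ b →
          D.residual ξ.ofLp b = -D.extq →
          D.dualForm x δ ξ.ofLp b 1 ≤ v.s i + D.extq ⬝ᵥ v.ψ i - v.lam * ‖D.sample i‖ ^ 2 +
            ∑ j, v.φ i j * D.extq j ^ 2 + v.lam * ‖ξ - D.sample i‖ ^ 2 :=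
        fun i ξ b hξ hb h => by
          rw [← D.linearForm_of_residual_eq i v ξ h]
          exact (D.isCopositive_copositiveMatrix_iff x δ v i).mp (hv i) _ _ _ hξ hb zero_le_one
      refine (D.lintegral_le_of_mem_ambiguitySet hradius hP _
        (fun i => v.s i + D.extq ⬝ᵥ v.ψ i - v.lam * ‖D.sample i‖ ^ 2 +
          ∑ j, v.φ i j * D.extq j ^ 2 + C) (fun i => ?_) v.lam hlam fun ξ hξ i => ?_).trans ?_
      · have h1 := key i (D.sample i) (b₀ i) (hsample i).1 (hb₀ i) (hres₀ i)
        have h2 := D.dualForm_anti x hδ1 (D.sample i).ofLp (b₀ i) 1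
        have h3 := hCi i
        rw [sub_self, norm_zero, zero_pow two_ne_zero, mul_zero, add_zero] at h1
        linarith
      · refine iSup₂_le fun b hb => ENNReal.ofReal_le_ofReal ?_
        have := key i ξ b hξ.1 hb.1 hb.2
        linarith
      · refine ENNReal.ofReal_le_ofReal ?_
        rw [copositiveObjective] at hobj
        rw [Finset.sum_add_distrib, mul_add]
        have : 1 / (I : ℝ) * ∑ _i : Fin I, C = C := by
          rw [Finset.sum_const, Finset.card_univ, Fintype.card_fin, nsmul_eq_mul]
          field_simp
        rw [this]
        linarith
    have hlim : Tendsto (fun η : ℝ => ENNReal.ofReal (L + η + C)) (𝓝[>] 0)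
        (𝓝 (ENNReal.ofReal (L + 0 + C))) := by
      refine Tendsto.mono_left (Continuous.tendsto ?_ 0) nhdsWithin_le_nhds
      exact ENNReal.continuous_ofReal.comp (by fun_prop)
    rw [add_zero] at hlim
    exact ge_of_tendsto hlim (eventually_nhdsWithin_of_forall hη)
  -- Monotone convergence along `δ = 1 / (n + 1)`. For each fixed dual point `b` the penalty
  -- disappears in the limit, so the supremum bounds every unregularized dual value and, by strong
  -- duality of the recourse problem, the recourse itself.
  let F : ℕ → EuclideanSpace ℝ (Fin K) → ℝ≥0∞ := fun n =>
    D.regularizedRecourse x (1 / ((n : ℝ) + 1)) C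
  have hFmeas : ∀ n, Measurable (F n) := fun n => D.measurable_regularizedRecourse x _ C
  have hFmono : Monotone F := fun n m hnm ξ => by
    refine iSup₂_mono fun b _ => ENNReal.ofReal_le_ofReal ?_
    have := D.dualForm_anti x (Nat.one_div_le_one_div (α := ℝ) hnm) ξ.ofLp b 1
    linarith
  have hae : ∀ᵐ ξ ∂P, ξ ∈ D.support := hP.1.2.1
  refine extExpectation_le_of_add_le (Measurable.iSup hFmeas) hC hLC ?_ ?_
  · filter_upwards [hae] with ξ hξ htop
    refine D.recourse_le_of_forall_dualForm_le x hrec hξ _ fun b hb hres => ?_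
    have hn : ∀ n : ℕ, D.dualForm x 0 ξ.ofLp b 1 - 1 / ((n : ℝ) + 1) * (b ⬝ᵥ b) ≤
        (⨆ n, F n ξ).toReal - C := fun n => by
      have h1 : ENNReal.ofReal (D.dualForm x (1 / ((n : ℝ) + 1)) ξ.ofLp b 1 + C) ≤ ⨆ n, F n ξ :=
        le_trans (le_iSup₂_of_le b ⟨hb, hres⟩ le_rfl) (le_iSup (fun n => F n ξ) n)
      have h2 := (ENNReal.ofReal_le_iff_le_toReal htop).mp h1
      simp only [dualForm, zero_mul, sub_zero] at h2 ⊢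
      linarith
    have hlim : Tendsto (fun n : ℕ => D.dualForm x 0 ξ.ofLp b 1 - 1 / ((n : ℝ) + 1) * (b ⬝ᵥ b))
        atTop (𝓝 (D.dualForm x 0 ξ.ofLp b 1 - 0 * (b ⬝ᵥ b))) :=
      tendsto_const_nhds.sub (tendsto_one_div_add_atTop_nhds_zero_nat.mul_const _)
    rw [zero_mul, sub_zero] at hlim
    exact le_of_tendsto' hlim hn
  · rw [lintegral_iSup hFmeas hFmono]
    refine iSup_le fun n => hint _ (by positivity) ?_
    rw [div_le_one (by positivity)]
    have : (0 : ℝ) ≤ n := Nat.cast_nonneg n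
    linarith

/-! ### Comparison of the optimal values and passage to the limit -/

theorem copositiveValue_anti (x : Fin N₁ → ℝ) {δ δ' : ℝ} (h : δ ≤ δ') :
    D.copositiveValue δ' x ≤ D.copositiveValue δ x := by
  refine le_iInf₂ fun v hv => iInf₂_le v ⟨hv.1, fun i => ?_⟩
  rw [isCopositive_copositiveMatrix_iff]
  intro a b c ha hb hc
  exact (D.dualForm_anti x h a b c).trans
    ((D.isCopositive_copositiveMatrix_iff x δ v i).mp (hv.2 i) a b c ha hb hc)

theorem completelyPositiveValue_le_copositiveValue (x : Fin N₁ → ℝ) (δ : ℝ) :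
    D.completelyPositiveValue δ x ≤ D.copositiveValue δ x :=
  iSup₂_le fun _ hv => le_iInf₂ fun _ hw => EReal.coe_le_coe_iff.mpr
    (D.completelyPositiveObjective_le_copositiveObjective x δ hv hw.1 hw.2)

theorem copositiveValue_ne_bot (hsample : ∀ i, D.sample i ∈ D.support)
    (hrec : D.SufficientlyExpensiveRecourse) (x : Fin N₁ → ℝ) (δ : ℝ) :
    D.copositiveValue δ x ≠ ⊥ := by
  obtain ⟨v, hv⟩ := D.exists_completelyPositiveFeasible hsample hrec
  refine ne_bot_of_le_ne_bot (EReal.coe_ne_bot (D.completelyPositiveObjective x δ v)) ?_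
  refine le_trans ?_ (D.completelyPositiveValue_le_copositiveValue x δ)
  exact le_iSup₂ (f := fun v _ => ((D.completelyPositiveObjective x δ v : ℝ) : EReal)) v hv

theorem copositiveValue_eq_completelyPositiveValue (hI : 0 < I)
    (hsample : ∀ i, D.sample i ∈ D.support) (hrec : D.SufficientlyExpensiveRecourse)
    (x : Fin N₁ → ℝ) {δ : ℝ} (hδ : 0 < δ) :
    D.copositiveValue δ x = D.completelyPositiveValue δ x := by
  refine le_antisymm ?_ (D.completelyPositiveValue_le_copositiveValue x δ)
  rw [← EReal.coe_toReal (D.copositiveValue_ne_top x hδ)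
    (D.copositiveValue_ne_bot hsample hrec x δ)]
  obtain ⟨v, hv, hle⟩ := D.exists_completelyPositiveFeasible_ge hI x hδ
    (D.copositiveValue δ x).toReal (fun w hw => by
      rw [← EReal.coe_le_coe_iff, EReal.coe_toReal (D.copositiveValue_ne_top x hδ)
        (D.copositiveValue_ne_bot hsample hrec x δ)]
      exact iInf₂_le w hw)
  refine (EReal.coe_le_coe_iff.mpr hle).trans ?_
  exact le_iSup₂ (f := fun v _ => ((D.completelyPositiveObjective x δ v : ℝ) : EReal)) v hv

theorem completelyPositiveValue_le_worstCase (hI : 0 < I) (hradius : 0 ≤ D.radius)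
    (hsample : ∀ i, D.sample i ∈ D.support) (hrec : D.SufficientlyExpensiveRecourse)
    (x : Fin N₁ → ℝ) {δ : ℝ} (hδ : 0 ≤ δ) :
    D.completelyPositiveValue δ x ≤ D.worstCase x := by
  refine iSup₂_le fun v hv => le_trans (EReal.coe_le_coe_iff.mpr ?_)
    (D.completelyPositiveObjective_le_worstCase hI hradius hsample hrec x hv)
  unfold completelyPositiveObjective
  gcongr with i
  exact (hv.Γ_psd i).trace_nonneg

end TwoStageDRLP

theorem mainTheorem5 {N₁ N₂ K M J I : ℕ} (D : TwoStageDRLP N₁ N₂ K M J I)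
    (hI : 0 < I) (hradius : 0 ≤ D.radius) (hsample : ∀ i, D.sample i ∈ D.support)
    (hrecourse : D.SufficientlyExpensiveRecourse)
    (x : Fin N₁ → ℝ) (hx : x ∈ D.X) :
    (∀ δ : ℝ, 0 < δ →
      D.copositiveValue δ x = D.completelyPositiveValue δ x ∧
      D.copositiveValue δ x ≠ ⊤ ∧ D.copositiveValue δ x ≠ ⊥) ∧
    Tendsto (fun δ : ℝ => D.copositiveValue δ x) (𝓝[>] 0) (𝓝 (D.worstCase x)) := by
  refine ⟨fun δ hδ => ⟨D.copositiveValue_eq_completelyPositiveValue hI hsample hrecourse x hδ,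
    D.copositiveValue_ne_top x hδ, D.copositiveValue_ne_bot hsample hrecourse x δ⟩,
    tendsto_order.mpr ⟨fun l hl => ?_, fun u hu => ?_⟩⟩
  -- Otherwise `l` bounds all copositive values and hence, when it is real, the worst case.
  -- Monotonicity in `δ` extends the strict inequality from `δ₀` to all smaller `δ`.
  · obtain ⟨δ₀, hδ₀, hlt⟩ : ∃ δ₀ : ℝ, 0 < δ₀ ∧ l < D.copositiveValue δ₀ x := by
      by_contra hno
      push Not at hno
      induction l with
      | bot => exact D.copositiveValue_ne_bot hsample hrecourse x 1 (le_bot_iff.mp (hno 1 one_pos))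
      | top => exact not_top_lt hl
      | coe L =>
        exact hl.not_ge
          (D.worstCase_le_of_copositiveValue_le hI hradius hsample hrecourse x L hno)
    filter_upwards [Ioc_mem_nhdsGT hδ₀] with δ hδ
    exact hlt.trans_le (D.copositiveValue_anti x hδ.2)
  · filter_upwards [self_mem_nhdsWithin] with δ hδ
    rw [D.copositiveValue_eq_completelyPositiveValue hI hsample hrecourse x hδ]
    exact (D.completelyPositiveValue_le_worstCase hI hradius hsample hrecourse x
      (le_of_lt hδ)).trans_lt hu
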